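/- An iterated function system is a finite family $\mathcal I=\{f_1,\dots,f_m\}$ of self-maps of $\mathbb R$ with a common Lipschitz constant $<1$; its attractor $K$ is the unique nonempty compact set with $K=\bigcup_i f_i(K)$. We call $\mathcal I$ regular and normalized if the $f_i$ are $C^2$, the convex hull of $K$ is $I=[0,1]$, the sets $f_i(I)$ are pairwise disjoint, and each $f_i:I\to f_i(I)$ is a diffeomorphism. For each $m$, the set of regular normalized systems with $m$ maps carries the $C^2$ topology (uniform convergence on $[0,1]$ of the maps and of their first two derivatives). For a finite word $u=(u_1,\dots,u_j)$ let $f_u=f_{u_1}\circ\cdots\circ f_{u_j}$, and let $I(u)$ be the convex hull of $f_u(K)$. Let $\mathcal I^1,\mathcal I^2$ be regular normalized systems with attractors $K^1,K^2$ and let $d=\dim_H K^1+\dim_H K^2$. For $\rho>0$ the $\rho$-decomposition $\Lambda(\rho)$ of $K^1\times K^2$ is the finite set of pairs of words $(u_1,u_2)$ such that, for $i=1,2$, $|I^i(u_i)|>\rho$ but $|I^i(v)|\le\rho$ for every word $v$ that has $u_i$ as a proper initial subword. Put $Q(u_1,u_2)=I^1(u_1)\times I^2(u_2)$ and $\Pi_\lambda(x,y)=x+\lambda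 y$. Proposition. Let $m_1,m_2$ be fixed. There is a function $\rho_0=\rho_0(\eta,A,\mathcal I^1,\mathcal I^2)>0$, defined and continuous on the set of all $\eta>0$, $A>0$ and regular normalized systems $\mathcal I^1,\mathcal I^2$ with $m_1$ and $m_2$ maps such that $d<1$, with the following property. For all such $\eta,A,\mathcal I^1,\mathcal I^2$ and all $0<\rho<\rho_0$ there is a measurable set $J\subset[-A,A]$ such that 1. $\mathcal L([-A,A]\setminus J)<\rho^{\eta}$, where $\mathcal L$ is Lebesgue measure; 2. for every $\lambda\in J$ and every $\mathcal R\subset\Lambda(\rho)$ with $\#\mathcal R>\rho^{\eta-d}$ there is $\mathcal R'\subset\mathcal R$ with $\#\mathcal R'>\rho^{4\eta-d}$ such that the sets $\Pi_\lambda(Q(u))$, $u\in\mathcal R'$, are pairwise disjoint. -/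

import Mathlib

open Set MeasureTheory

noncomputable section

/-- A `C²` iterated function system with `m` maps on the real line: `C²` self-maps of `ℝ` with a
common Lipschitz constant `L < 1`. -/
structure IsC2IFS {m : ℕ} (f : Fin m → ℝ → ℝ) : Prop where
  contDiff : ∀ i, ContDiff ℝ 2 (f i)
  contracting : ∃ L : ℝ, L < 1 ∧ ∀ i x y, |f i x - f i y| ≤ L * |x - y|

/-- `K` is a nonempty compact set with `K = ⋃ i, f i (K)`. -/
structure IsAttractor {m : ℕ} (f : Fin m → ℝ → ℝ) (K : Set ℝ) : Prop where
  isCompact : IsCompact K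
  nonempty : K.Nonempty
  eq_iUnion : K = ⋃ i, f i '' K

/-- The attractor of an i.f.s. It is the only set satisfying `IsAttractor f`, see
`IsAttractor.eq_attractor`. -/
def attractor {m : ℕ} (f : Fin m → ℝ → ℝ) : Set ℝ :=
  ⋃₀ {K | IsAttractor f K}

theorem IsAttractor.subset {m : ℕ} {f : Fin m → ℝ → ℝ} (hf : IsC2IFS f) {K K' : Set ℝ}
    (hK : IsAttractor f K) (hK' : IsAttractor f K') : K ⊆ K' := by
  obtain ⟨L, hL, hLip⟩ := hf.contracting
  obtain ⟨x₀, hx₀, hmax⟩ := hK.isCompact.exists_isMaxOn hK.nonempty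
    (Metric.continuous_infDist_pt K').continuousOn
  have h0 : Metric.infDist x₀ K' ≤ 0 := by
    have hx := hx₀
    rw [hK.eq_iUnion] at hx
    obtain ⟨i, y, hy, rfl⟩ := mem_iUnion.1 hx
    obtain ⟨z, hz, hyz⟩ := hK'.isCompact.exists_infDist_eq_dist hK'.nonempty y
    have hfz : f i z ∈ K' := by
      rw [hK'.eq_iUnion]
      exact mem_iUnion.2 ⟨i, z, hz, rfl⟩
    have h1 : Metric.infDist (f i y) K' ≤ L * Metric.infDist y K' := by
      rw [hyz, Real.dist_eq]
      exact (Metric.infDist_le_dist_of_mem hfz).trans (by rw [Real.dist_eq]; exact hLip i y z)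
    have h2 : Metric.infDist y K' ≤ Metric.infDist (f i y) K' := hmax hy
    have h3 : 0 ≤ Metric.infDist y K' := Metric.infDist_nonneg
    rcases h3.eq_or_lt with h4 | h4
    · rw [← h4, mul_zero] at h1
      exact h1
    · nlinarith
  intro x hx
  rw [hK'.isCompact.isClosed.mem_iff_infDist_zero hK'.nonempty]
  exact le_antisymm ((hmax hx).trans h0) Metric.infDist_nonneg

theorem IsAttractor.eq_attractor {m : ℕ} {f : Fin m → ℝ → ℝ} (hf : IsC2IFS f) {K : Set ℝ}
    (hK : IsAttractor f K) : attractor f = K :=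
  Subset.antisymm (sUnion_subset fun _ h => IsAttractor.subset hf h hK) (subset_sUnion_of_mem hK)

/-- Regularity: with `I` the convex hull of the attractor, the sets `f i (I)` are pairwise
disjoint, and each `f i` restricts to a diffeomorphism of `I` onto `f i (I)`. -/
structure IsRegularIFS {m : ℕ} (f : Fin m → ℝ → ℝ) : Prop where
  pairwise_disjoint : Pairwise fun i j =>
    Disjoint (f i '' convexHull ℝ (attractor f)) (f j '' convexHull ℝ (attractor f))
  injOn : ∀ i, InjOn (f i) (convexHull ℝ (attractor f))
  deriv_ne_zero : ∀ i, ∀ x ∈ convexHull ℝ (attractor f), deriv (f i) x ≠ 0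

/-- The space of regular normalized `C²` iterated function systems with `m` maps; normalized means
that the convex hull of the attractor is the unit interval. -/
structure RegularNormalizedIFS (m : ℕ) where
  map : Fin m → ℝ → ℝ
  isC2IFS : IsC2IFS map
  isRegular : IsRegularIFS map
  normalized : convexHull ℝ (attractor map) = Icc 0 1

namespace RegularNormalizedIFS

variable {m : ℕ}

/-- The derivatives of order `0, 1, 2` of the maps, as continuous functions on `[0,1]`. -/
def jet (F : RegularNormalizedIFS m) (i : Fin m) (k : Fin 3) : C(Icc (0 : ℝ) 1, ℝ) where
  toFun x := iteratedDeriv (k : ℕ) (F.map i) x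
  continuous_toFun :=
    ((F.isC2IFS.contDiff i).continuous_iteratedDeriv (k : ℕ)
      (by exact_mod_cast Nat.le_of_lt_succ k.isLt)).comp continuous_subtype_val

/-- The `C²` topology: uniform convergence on `[0,1]` of the maps and of their first and second
derivatives. -/
instance : TopologicalSpace (RegularNormalizedIFS m) :=
  TopologicalSpace.induced jet inferInstance

/-- The attractor `K` of the system. -/
def K (F : RegularNormalizedIFS m) : Set ℝ := attractor F.map

/-- The Hausdorff dimension of the attractor (finite, being at most `1`). -/
def dim (F : RegularNormalizedIFS m) : ℝ := (dimH F.K).toReal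

/-- `f_u = f_{u₁} ∘ ⋯ ∘ f_{u_j}` for a finite word `u`. -/
def wordMap (F : RegularNormalizedIFS m) : List (Fin m) → ℝ → ℝ
  | [] => id
  | i :: u => F.map i ∘ wordMap F u

/-- The cylinder set `K(u) = f_u(K)`. -/
def cylinder (F : RegularNormalizedIFS m) (u : List (Fin m)) : Set ℝ := F.wordMap u '' F.K

/-- The convex hull `I(u)` of the cylinder set `K(u)`. -/
def cylinderHull (F : RegularNormalizedIFS m) (u : List (Fin m)) : Set ℝ :=
  convexHull ℝ (F.cylinder u)

/-- `|I(u)| = diam K(u) > ρ`, and this fails for every word having `u` as a proper initial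
subword. -/
def IsScaleWord (F : RegularNormalizedIFS m) (ρ : ℝ) (u : List (Fin m)) : Prop :=
  ρ < Metric.diam (F.cylinder u) ∧
    ∀ v : List (Fin m), u <+: v → v ≠ u → ¬ ρ < Metric.diam (F.cylinder v)

end RegularNormalizedIFS

variable {m₁ m₂ : ℕ}

/-- The `ρ`-decomposition `Λ(ρ)` of `Λ = K¹ × K²`. -/
def rhoDecomposition (F₁ : RegularNormalizedIFS m₁) (F₂ : RegularNormalizedIFS m₂) (ρ : ℝ) :
    Set (List (Fin m₁) × List (Fin m₂)) :=
  {u | F₁.IsScaleWord ρ u.1 ∧ F₂.IsScaleWord ρ u.2}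

/-- The rectangle `Q^φ(u₁, u₂) = φ₁(I¹(u₁)) × φ₂(I²(u₂))`. -/
def rect (F₁ : RegularNormalizedIFS m₁) (F₂ : RegularNormalizedIFS m₂) (φ : (ℝ → ℝ) × (ℝ → ℝ))
    (u : List (Fin m₁) × List (Fin m₂)) : Set (ℝ × ℝ) :=
  (φ.1 '' F₁.cylinderHull u.1) ×ˢ (φ.2 '' F₂.cylinderHull u.2)

/-- `Π_l (x, y) = x + l y`. -/
def proj (l : ℝ) (p : ℝ × ℝ) : ℝ := p.1 + l * p.2

/-- The family `R` of elements of the `ρ`-decomposition is `(η, l, φ)`-faithful: it has a subfamily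
with more than `ρ ^ (η - d)` elements, `d = dim K¹ + dim K²`, such that the projections under
`Π_l` of its rectangles `Q^φ` are pairwise disjoint. -/
def IsFaithful (F₁ : RegularNormalizedIFS m₁) (F₂ : RegularNormalizedIFS m₂) (ρ η l : ℝ)
    (φ : (ℝ → ℝ) × (ℝ → ℝ)) (R : Finset (List (Fin m₁) × List (Fin m₂))) : Prop :=
  ∃ R' ⊆ R, ρ ^ (η - (F₁.dim + F₂.dim)) < (R'.card : ℝ) ∧
    (R' : Set (List (Fin m₁) × List (Fin m₂))).PairwiseDisjoint
      fun u => proj l '' rect F₁ F₂ φ u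

namespace RegularNormalizedIFS

variable {m : ℕ}

theorem isAttractor (F : RegularNormalizedIFS m) : IsAttractor F.map F.K := by
  have h : F.K.Nonempty := by
    rw [← convexHull_nonempty_iff (𝕜 := ℝ), K, F.normalized]
    exact ⟨0, by simp⟩
  obtain ⟨x, K', hK', -⟩ := h
  rw [K, IsAttractor.eq_attractor F.isC2IFS hK']
  exact hK'

theorem diam_cylinder_le (F : RegularNormalizedIFS m) : ∃ L : ℝ, 0 ≤ L ∧ L < 1 ∧
    ∀ u, Metric.diam (F.cylinder u) ≤ L ^ u.length * Metric.diam F.K := by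
  obtain ⟨L, hL, hLip⟩ := F.isC2IFS.contracting
  refine ⟨max L 0, le_max_right _ _, max_lt hL one_pos, fun u => ?_⟩
  have key : ∀ (u : List (Fin m)) (x y : ℝ),
      dist (F.wordMap u x) (F.wordMap u y) ≤ max L 0 ^ u.length * dist x y := by
    intro u x y
    induction u with
    | nil => simp [wordMap]
    | cons i u ih =>
      simp only [wordMap, Function.comp, List.length_cons, pow_succ']
      rw [Real.dist_eq]
      refine (hLip i _ _).trans ?_
      rw [mul_assoc]
      exact mul_le_mul (le_max_left _ _) (by rw [← Real.dist_eq]; exact ih) (abs_nonneg _)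
        (le_max_right _ _)
  have hb := F.isAttractor.isCompact.isBounded
  refine Metric.diam_le_of_forall_dist_le (by positivity) ?_
  rintro _ ⟨x, hx, rfl⟩ _ ⟨y, hy, rfl⟩
  exact (key u x y).trans
    (mul_le_mul_of_nonneg_left (Metric.dist_le_diam_of_mem hb hx hy) (by positivity))

theorem finite_isScaleWord (F : RegularNormalizedIFS m) {ρ : ℝ} (hρ : 0 < ρ) :
    {u | F.IsScaleWord ρ u}.Finite := by
  obtain ⟨L, hL0, hL1, h⟩ := F.diam_cylinder_le
  have ht : Filter.Tendsto (fun n : ℕ => L ^ n * Metric.diam F.K) Filter.atTop (nhds 0) := by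
    simpa using (tendsto_pow_atTop_nhds_zero_of_lt_one hL0 hL1).mul_const (Metric.diam F.K)
  obtain ⟨N, hN⟩ := Filter.eventually_atTop.1 (ht.eventually_lt_const hρ)
  refine (List.finite_length_lt (Fin m) N).subset fun u hu => ?_
  by_contra hlt
  have h1 : ρ < _ := hu.1
  have h2 := hN u.length (not_lt.1 hlt)
  linarith [h u]

end RegularNormalizedIFS

/-- The `ρ`-decomposition is finite, so its subsets are the finsets contained in it. -/
theorem rhoDecomposition_finite (F₁ : RegularNormalizedIFS m₁) (F₂ : RegularNormalizedIFS m₂)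
    {ρ : ℝ} (hρ : 0 < ρ) : (rhoDecomposition F₁ F₂ ρ).Finite :=
  ((F₁.finite_isScaleWord hρ).prod (F₂.finite_isScaleWord hρ)).subset fun _ h => h

end

open Set MeasureTheory Filter Topology

noncomputable section

variable {m₁ m₂ : ℕ}

/-! Call `u`, `v` in `Λ(ρ)` near at `l` if their base points project under `Π_l` to points at
distance at most `cρ`; rectangles with intersecting projections are near. Let `X`, `Y` be the
coordinate differences of the base points. The parameters with `|X + lY| ≤ cρ` form a set of measure
at most `2cρ/|Y|`. Nearness with `|l| ≤ A` also forces `|X| ≲ 2^k ρ` once `|Y| ≤ 2^k ρ`, and a box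
of side about `2^k ρ` meets `≲ 2^(kd) ≤ 2^k` rectangles because `d < 1`. So each dyadic scale
contributes a bounded amount to the sum over `v` of these measures, and the sum over all pairs is `≲
ρ^(-d) log(1/ρ)`.

By Markov's inequality, outside a set of measure less than `ρ^η` fewer than `T = ρ^(-d-3η/2)` pairs
are near. This set is chosen before the subfamily `R`. For a good `l`, the nearness graph on `R` has
an independent set of size at least `#R²/(4T)`, which exceeds `ρ^(4η-d)` for small `ρ`.

The counts need constants that are locally uniform in the systems. Bounded distortion compares `f_u`
with a similarity of ratio `|I(u)|`, up to a factor `D` that is locally constant in the `C²`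
topology. An antichain of `N` words of size at least `r` then has `N ≤ (D/r)^dim K`: coding points
by base-`N` digits gives a Hölder map from a subset of `K` onto `[0,1]`. No further constant and no
continuity of the dimension is involved. A threshold that works locally uniformly is finally
replaced by a continuous one (`exists_continuousOn_radius`). -/

/-! ### Continuous choice of a radius -/

/-- A property of positive radii which is inherited by smaller radii and holds locally uniformly on
a set holds for a radius that depends continuously on the point. -/
theorem exists_continuousOn_radius {X : Type*} [TopologicalSpace X]
    [TopologicalSpace.PseudoMetrizableSpace X] (S : Set X) (P : X → ℝ → Prop)
    (hmono : ∀ x r r', r' ≤ r → P x r → P x r')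
    (hloc : ∀ x ∈ S, ∃ r > 0, ∀ᶠ y in 𝓝 x, y ∈ S → P y r) :
    ∃ ρ : X → ℝ, ContinuousOn ρ S ∧ ∀ x ∈ S, 0 < ρ x ∧ P x (ρ x) := by
  let : PseudoMetricSpace X := TopologicalSpace.pseudoMetrizableSpacePseudoMetric X
  -- The same `r` is the size of the ball and the radius in `P`. Moving the centre by `δ` costs at
  -- most `δ` in `r`, so the supremum is 1-Lipschitz. The cap `1` keeps it finite, and `0` belongs
  -- vacuously.
  let T : X → Set ℝ := fun x => {r | r ≤ 1 ∧ ∀ y, dist y x < r → y ∈ S → P y r}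
  have hT0 : ∀ x, (0 : ℝ) ∈ T x := fun x =>
    ⟨zero_le_one, fun y hy => absurd hy (not_lt.2 dist_nonneg)⟩
  have hTb : ∀ x, BddAbove (T x) := fun x => ⟨1, fun r hr => hr.1⟩
  have hg0 : ∀ x, 0 ≤ sSup (T x) := fun x => le_csSup (hTb x) (hT0 x)
  have hlip : ∀ x y, sSup (T x) ≤ sSup (T y) + 1 * dist x y := by
    intro x y
    rw [one_mul]
    refine csSup_le ⟨0, hT0 x⟩ fun r hr => ?_
    have h : r - dist x y ∈ T y := by
      refine ⟨by linarith [hr.1, dist_nonneg (x := x) (y := y)], fun z hz hzS => ?_⟩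
      refine hmono z r _ (by linarith [dist_nonneg (x := x) (y := y)]) (hr.2 z ?_ hzS)
      linarith [dist_triangle z y x, dist_comm x y]
    linarith [le_csSup (hTb y) h]
  have hpos : ∀ x ∈ S, 0 < sSup (T x) := by
    intro x hx
    obtain ⟨r, hr, h⟩ := hloc x hx
    obtain ⟨ε, hε, hball⟩ := Metric.eventually_nhds_iff.1 h
    have hm : min (min r ε) 1 ∈ T x := by
      refine ⟨min_le_right _ _, fun y hy hyS => ?_⟩
      refine hmono y r _ ((min_le_left _ _).trans (min_le_left _ _)) (hball ?_ hyS)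
      exact hy.trans_le ((min_le_left _ _).trans (min_le_right _ _))
    exact lt_of_lt_of_le (by positivity) (le_csSup (hTb x) hm)
  -- The supremum need not be attained; half of it lies below an element of `T x`.
  refine ⟨fun x => sSup (T x) / 2, ?_, fun x hx => ⟨half_pos (hpos x hx), ?_⟩⟩
  · exact ((LipschitzWith.of_le_add_mul 1 fun x y => by
      simpa using hlip x y).continuous.div_const 2).continuousOn
  · obtain ⟨r, hr, hlt⟩ := exists_lt_of_lt_csSup ⟨0, hT0 x⟩ (half_lt_self (hpos x hx))
    refine hmono x r _ hlt.le (hr.2 x ?_ hx)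
    rw [dist_self]
    exact (half_pos (hpos x hx)).trans hlt

/-! ### A lower bound for the Hausdorff dimension -/

/-- Finitely many pairwise disjoint compact sets have positive mutual distances. -/
theorem exists_pos_forall_lt_abs_sub {ι : Type*} [Finite ι] {K : ι → Set ℝ}
    (hK : ∀ i, IsCompact (K i)) (hd : Pairwise fun i j => Disjoint (K i) (K j)) :
    ∃ δ > 0, ∀ i j, i ≠ j → ∀ x ∈ K i, ∀ y ∈ K j, δ < |x - y| := by
  have h : ∀ᶠ δ : ℝ in 𝓝[>] 0, ∀ i j, i ≠ j → ∀ x ∈ K i, ∀ y ∈ K j, δ < |x - y| := by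
    rw [eventually_all]
    intro i
    rw [eventually_all]
    intro j
    by_cases hij : i = j
    · simp [hij]
    obtain ⟨r, hr, h⟩ := Metric.exists_pos_forall_lt_edist (hK i) (hK j).isClosed (hd hij)
    filter_upwards [Ioo_mem_nhdsGT (show (0 : ℝ) < r by exact_mod_cast hr)] with δ hδ _ x hx y hy
    have := h x hx y hy
    rw [edist_dist, ENNReal.lt_ofReal_iff_toReal_lt ENNReal.coe_ne_top, ENNReal.coe_toReal,
      Real.dist_eq] at this
    exact hδ.2.trans this
  obtain ⟨δ, h, hδ⟩ := (h.and self_mem_nhdsWithin).exists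
  exact ⟨δ, hδ, h⟩

/-- `N` self-maps of a compact set of reals with pairwise disjoint images which contract distances
at most by the factor `q` force the dimension to be at least `log N / log (1 / q)`. -/
theorem natCast_le_rpow_dimH {K : Set ℝ} (hK : IsCompact K) (hne : K.Nonempty) {N : ℕ}
    (hN : 2 ≤ N) (g : Fin N → ℝ → ℝ) (hcont : ∀ j, Continuous (g j)) (hmaps : ∀ j, MapsTo (g j) K K)
    (hdisj : Pairwise fun i j => Disjoint (g i '' K) (g j '' K)) {q : ℝ} (hq : 0 < q) (hq1 : q < 1)
    (hexp : ∀ j, ∀ x ∈ K, ∀ y ∈ K, q * |x - y| ≤ |g j x - g j y|) :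
    (N : ℝ) ≤ (1 / q) ^ (dimH K).toReal := by
  -- `G a n = g (a 0) ∘ ⋯ ∘ g (a (n - 1))`: new maps enter innermost, so the images of `K` are
  -- nested and each sequence `a` codes a point `x a`.
  let G : (ℕ → Fin N) → ℕ → ℝ → ℝ := fun a n => Nat.rec id (fun k h => h ∘ g (a k)) n
  have hG0 : ∀ a, G a 0 = id := fun a => rfl
  have hGs : ∀ a n, G a (n + 1) = G a n ∘ g (a n) := fun a n => rfl
  have hGc : ∀ a n, Continuous (G a n) := by
    intro a n
    induction n with
    | zero => exact continuous_id
    | succ n ih => exact ih.comp (hcont _)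
  have hGexp : ∀ a n, ∀ x ∈ K, ∀ y ∈ K, q ^ n * |x - y| ≤ |G a n x - G a n y| := by
    intro a n
    induction n with
    | zero => intro x _ y _; simp [hG0]
    | succ n ih =>
      intro x hx y hy
      have h1 := ih _ (hmaps (a n) hx) _ (hmaps (a n) hy)
      have h2 := mul_le_mul_of_nonneg_left (hexp (a n) x hx y hy) (pow_nonneg hq.le n)
      rw [hGs, pow_succ, mul_assoc]
      exact h2.trans h1
  have hGagree : ∀ a b n, (∀ i < n, a i = b i) → G a n = G b n := by
    intro a b n
    induction n with
    | zero => intro _; rfl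
    | succ n ih =>
      intro h
      rw [hGs, hGs, ih fun i hi => h i (hi.trans n.lt_succ_self), h n n.lt_succ_self]
  have hpt : ∀ a, ∃ x, ∀ n, x ∈ G a n '' K := by
    intro a
    obtain ⟨x, hx⟩ := IsCompact.nonempty_iInter_of_sequence_nonempty_isCompact_isClosed
      (fun n => G a n '' K)
      (fun n => by
        show G a (n + 1) '' K ⊆ G a n '' K
        rw [hGs, image_comp]
        exact image_mono (hmaps _).image_subset)
      (fun n => hne.image _) (hK.image (hGc a 0)) (fun n => (hK.image (hGc a n)).isClosed)
    exact ⟨x, fun n => mem_iInter.1 hx n⟩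
  choose x hx using hpt
  have hxK : ∀ a, x a ∈ K := fun a => by simpa [hG0] using hx a 0
  obtain ⟨δ, hδ, hsep⟩ := exists_pos_forall_lt_abs_sub (fun j => hK.image (hcont j)) hdisj
  -- After the common initial maps are removed, the two points lie in different first-level images,
  -- hence at distance more than `δ`.
  have hfar : ∀ a b n, (∀ i < n, a i = b i) → a n ≠ b n → q ^ n * δ ≤ |x a - x b| := by
    intro a b n hlt hn
    obtain ⟨y, hy, hya⟩ := hx a (n + 1)
    obtain ⟨z, hz, hzb⟩ := hx b (n + 1)
    rw [← hya, ← hzb, hGs, hGs, hGagree a b n hlt]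
    refine le_trans ?_ (hGexp b n _ (hmaps (a n) hy) _ (hmaps (b n) hz))
    exact mul_le_mul_of_nonneg_left
      (hsep _ _ hn _ (mem_image_of_mem _ hy) _ (mem_image_of_mem _ hz)).le (by positivity)
  have hinj : Function.Injective x := by
    intro a b hab
    by_contra hne
    have h := Function.ne_iff.1 hne
    have := hfar a b _ (fun i hi => not_not.1 (Nat.find_min h hi)) (Nat.find_spec h)
    rw [hab, sub_self, abs_zero] at this
    exact absurd this (not_le.2 (by positivity))
  have hN1 : (1 : ℝ) < N := by exact_mod_cast hN
  have hlogN : 0 < Real.log N := Real.log_pos hN1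
  have hlogq : 0 < Real.log (1 / q) := Real.log_pos (by rw [lt_div_iff₀ hq]; linarith)
  -- With `q ^ s = 1 / N`, agreement of `n` digits, which means distance at most `N ^ (-n)` in
  -- `[0,1]`, matches distance at least `q ^ n * δ` in `K`.
  set s : ℝ := Real.log N / Real.log (1 / q) with hs
  have hs0 : 0 < s := div_pos hlogN hlogq
  have hqs : (1 / q) ^ s = N := by
    rw [Real.rpow_def_of_pos (by positivity), hs, mul_div_cancel₀ _ hlogq.ne',
      Real.exp_log (by linarith)]
  have hhol : ∀ a b, |Real.ofDigits a - Real.ofDigits b| ≤ (1 / δ) ^ s * |x a - x b| ^ s := by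
    intro a b
    by_cases hab : a = b
    · rw [hab, sub_self, abs_zero]; positivity
    have h := Function.ne_iff.1 hab
    have hmin : ∀ i < Nat.find h, a i = b i := fun i hi => not_not.1 (Nat.find_min h hi)
    have h1 := hfar a b _ hmin (Nat.find_spec h)
    refine (Real.abs_ofDigits_sub_ofDigits_le hmin).trans ?_
    rw [← Real.mul_rpow (by positivity) (abs_nonneg _)]
    have h2 : q ^ (Nat.find h) ≤ 1 / δ * |x a - x b| := by
      rw [one_div, inv_mul_eq_div, le_div_iff₀ hδ]; exact h1
    refine le_trans (le_of_eq ?_) (Real.rpow_le_rpow (by positivity) h2 hs0.le)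
    rw [← hqs, ← Real.rpow_natCast, ← Real.rpow_natCast, ← Real.rpow_mul (by positivity),
      ← Real.rpow_mul hq.le, one_div, Real.inv_rpow hq.le, inv_inv, mul_comm]
  have : Nonempty (ℕ → Fin N) := ⟨fun _ => ⟨0, by omega⟩⟩
  -- Decoding is meaningful only on `range x`; its values elsewhere play no role.
  let Φ : ℝ → ℝ := fun t => Real.ofDigits (Function.invFun x t)
  have hΦ : ∀ a, Φ (x a) = Real.ofDigits a := fun a => by
    show Real.ofDigits (Function.invFun x (x a)) = _
    rw [Function.leftInverse_invFun hinj a]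
  have hHolder : HolderOnWith (Real.toNNReal ((1 / δ) ^ s)) (Real.toNNReal s) Φ (range x) := by
    rintro _ ⟨a, rfl⟩ _ ⟨b, rfl⟩
    rw [hΦ, hΦ, edist_dist, edist_dist, Real.dist_eq, Real.dist_eq, Real.coe_toNNReal _ hs0.le,
      ENNReal.ofReal_rpow_of_nonneg (abs_nonneg _) hs0.le,
      ← ENNReal.ofReal, ← ENNReal.ofReal_mul (by positivity)]
    exact ENNReal.ofReal_le_ofReal (hhol a b)
  have himg : Icc (0 : ℝ) 1 ⊆ Φ '' range x := by
    intro t ht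
    obtain ⟨a, -, ha⟩ := Real.ofDigits_SurjOn (b := N) (by omega) ht
    exact ⟨x a, mem_range_self a, by rw [hΦ, ha]⟩
  have hdim1 : dimH (Icc (0 : ℝ) 1) = 1 := by
    rw [Real.dimH_of_nonempty_interior (by rw [interior_Icc]; exact ⟨1 / 2, by norm_num⟩)]
    simp
  have hle : 1 ≤ dimH K / (Real.toNNReal s) := by
    rw [← hdim1]
    exact (dimH_mono himg).trans ((hHolder.dimH_image_le (by simpa using hs0)).trans
      (ENNReal.div_le_div_right (dimH_mono (range_subset_iff.2 hxK)) _))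
  have htop : dimH K ≠ ⊤ := by
    refine ne_top_of_le_ne_top ?_ (dimH_mono (subset_univ K))
    rw [Real.dimH_univ]; simp
  have hs' : ENNReal.ofReal s ≤ dimH K := by
    rw [ENNReal.le_div_iff_mul_le (by left; simpa using hs0) (by left; simp), one_mul] at hle
    exact hle
  rw [ENNReal.ofReal_le_iff_le_toReal htop] at hs'
  calc (N : ℝ) = (1 / q) ^ s := hqs.symm
    _ ≤ _ := Real.rpow_le_rpow_of_exponent_le (by rw [le_div_iff₀ hq]; linarith) hs'

/-! ### Independent sets in sparse graphs -/

/-- In a graph whose adjacency relation (loops included) has few pairs there is a large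
independent set. -/
theorem exists_pairwise_not_of_card_le {α : Type*} [DecidableEq α] (R : Finset α)
    (r : α → α → Prop) [DecidableRel r] (hsymm : ∀ a b, r a b → r b a) (hrefl : ∀ a, r a a) {T : ℝ}
    (hT : (((R ×ˢ R).filter fun p => r p.1 p.2).card : ℝ) ≤ T) :
    ∃ R' ⊆ R, (R.card : ℝ) ^ 2 ≤ 4 * T * R'.card ∧
      (R' : Set α).Pairwise fun a b => ¬ r a b := by
  classical
  let deg : α → ℕ := fun a => (R.filter fun b => r a b).card
  have hsum : ∑ a ∈ R, deg a = ((R ×ˢ R).filter fun p => r p.1 p.2).card := by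
    rw [Finset.card_filter, Finset.sum_product]
    exact Finset.sum_congr rfl fun a _ => Finset.card_filter _ _
  rcases R.eq_empty_or_nonempty with rfl | hRne
  · exact ⟨∅, subset_rfl, by simp, by simp⟩
  obtain ⟨n, hn⟩ : ∃ n : ℝ, n = R.card := ⟨_, rfl⟩
  rw [← hn]
  have hn0 : 0 < n := by rw [hn]; exact_mod_cast hRne.card_pos
  have hsumT : (∑ a ∈ R, (deg a : ℝ)) ≤ T := by
    rw [← Nat.cast_sum, hsum]; exact hT
  have hT0 : 0 ≤ T := le_trans (by positivity) hT
  -- Vertices of at most twice the permitted average degree `T / n`. They make up at least half of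
  -- `R`, since otherwise the degrees would sum to more than `T`.
  let low := R.filter fun a => n * deg a ≤ 2 * T
  have hlow : n ≤ 2 * (low.card : ℝ) := by
    have hsplit := Finset.card_filter_add_card_filter_not (s := R) (fun a => n * deg a ≤ 2 * T)
    have h1 : 2 * T * ((R.filter fun a => ¬ n * deg a ≤ 2 * T).card : ℝ) ≤ n * T := by
      calc _ = ∑ a ∈ R.filter (fun a => ¬ n * deg a ≤ 2 * T), 2 * T := by
            rw [Finset.sum_const, nsmul_eq_mul]; ring
        _ ≤ ∑ a ∈ R.filter (fun a => ¬ n * deg a ≤ 2 * T), n * deg a :=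
            Finset.sum_le_sum fun a ha => (not_le.1 (Finset.mem_filter.1 ha).2).le
        _ ≤ ∑ a ∈ R, n * deg a :=
            Finset.sum_le_sum_of_subset_of_nonneg (Finset.filter_subset _ _)
              fun a _ _ => by positivity
        _ = n * ∑ a ∈ R, (deg a : ℝ) := by rw [Finset.mul_sum]
        _ ≤ n * T := mul_le_mul_of_nonneg_left hsumT hn0.le
    have h2 : (low.card : ℝ) + ((R.filter fun a => ¬ n * deg a ≤ 2 * T).card : ℝ) = n := by
      have := congrArg (Nat.cast : ℕ → ℝ) hsplit
      rwa [Nat.cast_add, ← hn] at this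
    have hTpos : 0 < T := by
      obtain ⟨a, ha⟩ := hRne
      refine lt_of_lt_of_le ?_ hT
      have : (a, a) ∈ (R ×ˢ R).filter fun p => r p.1 p.2 := by simp [ha, hrefl]
      exact_mod_cast Finset.card_pos.2 ⟨_, this⟩
    have h3 : 2 * ((R.filter fun a => ¬ n * deg a ≤ 2 * T).card : ℝ) ≤ n := by
      have : T * (2 * ((R.filter fun a => ¬ n * deg a ≤ 2 * T).card : ℝ)) ≤ T * n := by linarith
      exact le_of_mul_le_mul_left this hTpos
    linarith
  let fam := low.powerset.filter fun s : Finset α => (s : Set α).Pairwise fun a b => ¬ r a b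
  -- A maximal independent subset of `low` dominates `low`, and each of its vertices covers at most
  -- `2T / n` others, itself included.
  obtain ⟨M, hM, hmax⟩ := fam.exists_max_image Finset.card ⟨∅, by simp [fam]⟩
  obtain ⟨hMlow, hMp⟩ := Finset.mem_filter.1 hM
  rw [Finset.mem_powerset] at hMlow
  have hcover : low ⊆ M.biUnion fun a => R.filter fun b => r a b := by
    intro b hb
    have hbR : b ∈ R := (Finset.mem_filter.1 hb).1
    rw [Finset.mem_biUnion]
    by_cases hbM : b ∈ M
    · exact ⟨b, hbM, Finset.mem_filter.2 ⟨hbR, hrefl b⟩⟩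
    by_contra hcon
    push Not at hcon
    have hno : ∀ a ∈ M, ¬ r a b := fun a ha hab => hcon a ha (Finset.mem_filter.2 ⟨hbR, hab⟩)
    have hins : insert b M ∈ fam := by
      refine Finset.mem_filter.2 ⟨Finset.mem_powerset.2 (Finset.insert_subset hb hMlow), ?_⟩
      rw [Finset.coe_insert]
      exact hMp.insert fun a ha _ => ⟨fun h => hno a ha (hsymm _ _ h), hno a ha⟩
    have := hmax _ hins
    rw [Finset.card_insert_of_notMem hbM] at this
    omega
  refine ⟨M, hMlow.trans (Finset.filter_subset _ _), ?_, hMp⟩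
  have h1 : (low.card : ℝ) ≤ ∑ a ∈ M, (deg a : ℝ) := by
    exact_mod_cast (Finset.card_le_card hcover).trans Finset.card_biUnion_le
  have h2 : n * low.card ≤ 2 * T * M.card := by
    calc n * low.card ≤ n * ∑ a ∈ M, (deg a : ℝ) := mul_le_mul_of_nonneg_left h1 hn0.le
      _ = ∑ a ∈ M, n * deg a := by rw [Finset.mul_sum]
      _ ≤ ∑ a ∈ M, 2 * T := Finset.sum_le_sum fun a ha => (Finset.mem_filter.1 (hMlow ha)).2
      _ = _ := by rw [Finset.sum_const, nsmul_eq_mul]; ring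
  nlinarith

/-! ### Geometry of words and cylinders -/

namespace RegularNormalizedIFS

variable {m : ℕ}

theorem K_subset_Icc (F : RegularNormalizedIFS m) : F.K ⊆ Icc 0 1 := by
  rw [← F.normalized]
  exact subset_convexHull ℝ _

/-- The hull of `K` lies to the right of `min K`, so normalization forces `min K = 0`. With `1 ∈ K`,
this lets `|I(u)|` be read off from `f_u(0)` and `f_u(1)`. -/
theorem zero_mem_K (F : RegularNormalizedIFS m) : (0 : ℝ) ∈ F.K := by
  obtain ⟨a, ha, hmin⟩ := F.isAttractor.isCompact.exists_isLeast F.isAttractor.nonempty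
  have h : convexHull ℝ F.K ⊆ Ici a := convexHull_min (fun x hx => hmin hx) (convex_Ici a)
  rw [K, F.normalized] at h
  have h1 : a ≤ 0 := h ⟨le_rfl, zero_le_one⟩
  have h2 : 0 ≤ a := (F.K_subset_Icc ha).1
  rwa [← le_antisymm h1 h2]

theorem one_mem_K (F : RegularNormalizedIFS m) : (1 : ℝ) ∈ F.K := by
  obtain ⟨a, ha, hmax⟩ := F.isAttractor.isCompact.exists_isGreatest F.isAttractor.nonempty
  have h : convexHull ℝ F.K ⊆ Iic a := convexHull_min (fun x hx => hmax hx) (convex_Iic a)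
  rw [K, F.normalized] at h
  have h1 : 1 ≤ a := h ⟨zero_le_one, le_rfl⟩
  have h2 : a ≤ 1 := (F.K_subset_Icc ha).2
  rwa [le_antisymm h1 h2]

theorem map_mem_K (F : RegularNormalizedIFS m) (i : Fin m) : MapsTo (F.map i) F.K F.K := by
  intro x hx
  rw [F.isAttractor.eq_iUnion]
  exact mem_iUnion.2 ⟨i, x, hx, rfl⟩

/-- A continuous injective function maps an interval between the images of its endpoints. -/
theorem image_Icc_subset_uIcc {f : ℝ → ℝ} (hf : ContinuousOn f (Icc 0 1))
    (hi : InjOn f (Icc 0 1)) : f '' Icc 0 1 ⊆ uIcc (f 0) (f 1) := by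
  rintro _ ⟨x, hx, rfl⟩
  have h0 : (0 : ℝ) ∈ Icc (0 : ℝ) 1 := ⟨le_rfl, zero_le_one⟩
  have h1 : (1 : ℝ) ∈ Icc (0 : ℝ) 1 := ⟨zero_le_one, le_rfl⟩
  rcases hf.strictMonoOn_of_injOn_Icc' zero_le_one hi with h | h
  · exact Icc_subset_uIcc ⟨h.monotoneOn h0 hx hx.1, h.monotoneOn hx h1 hx.2⟩
  · exact Icc_subset_uIcc' ⟨h.antitoneOn hx h1 hx.2, h.antitoneOn h0 hx hx.1⟩

theorem map_injOn (F : RegularNormalizedIFS m) (i : Fin m) : InjOn (F.map i) (Icc 0 1) := by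
  rw [← F.normalized]
  exact F.isRegular.injOn i

theorem map_disjoint (F : RegularNormalizedIFS m) {i j : Fin m} (hij : i ≠ j) :
    Disjoint (F.map i '' Icc 0 1) (F.map j '' Icc 0 1) := by
  rw [← F.normalized]
  exact F.isRegular.pairwise_disjoint hij

/-- The endpoints lie in `K`, so their images stay in `K ⊆ [0,1]`; monotonicity puts the other
values between them. -/
theorem map_mapsTo_Icc (F : RegularNormalizedIFS m) (i : Fin m) :
    MapsTo (F.map i) (Icc 0 1) (Icc 0 1) := by
  intro x hx
  have h := image_Icc_subset_uIcc (F.isC2IFS.contDiff i).continuous.continuousOn (F.map_injOn i)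
    (mem_image_of_mem _ hx)
  refine (ordConnected_Icc.uIcc_subset ?_ ?_) h
  · exact F.K_subset_Icc (F.map_mem_K i F.zero_mem_K)
  · exact F.K_subset_Icc (F.map_mem_K i F.one_mem_K)

theorem wordMap_append (F : RegularNormalizedIFS m) (u v : List (Fin m)) :
    F.wordMap (u ++ v) = F.wordMap u ∘ F.wordMap v := by
  induction u with
  | nil => rfl
  | cons i u ih => simp only [List.cons_append, wordMap, ih, Function.comp_assoc]

theorem wordMap_contDiff (F : RegularNormalizedIFS m) (u : List (Fin m)) :
    ContDiff ℝ 2 (F.wordMap u) := by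
  induction u with
  | nil => exact contDiff_id
  | cons i u ih => exact (F.isC2IFS.contDiff i).comp ih

theorem wordMap_continuous (F : RegularNormalizedIFS m) (u : List (Fin m)) :
    Continuous (F.wordMap u) := (F.wordMap_contDiff u).continuous

theorem wordMap_differentiable (F : RegularNormalizedIFS m) (u : List (Fin m)) :
    Differentiable ℝ (F.wordMap u) := (F.wordMap_contDiff u).differentiable (by norm_num)

theorem wordMap_mapsTo_Icc (F : RegularNormalizedIFS m) (u : List (Fin m)) :
    MapsTo (F.wordMap u) (Icc 0 1) (Icc 0 1) := by
  induction u with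
  | nil => exact mapsTo_id _
  | cons i u ih => exact (F.map_mapsTo_Icc i).comp ih

theorem wordMap_mapsTo_K (F : RegularNormalizedIFS m) (u : List (Fin m)) :
    MapsTo (F.wordMap u) F.K F.K := by
  induction u with
  | nil => exact mapsTo_id _
  | cons i u ih => exact (F.map_mem_K i).comp ih

theorem wordMap_injOn (F : RegularNormalizedIFS m) (u : List (Fin m)) :
    InjOn (F.wordMap u) (Icc 0 1) := by
  induction u with
  | nil => exact injOn_id _
  | cons i u ih => exact (F.map_injOn i).comp ih (F.wordMap_mapsTo_Icc u)

theorem image_wordMap_subset_uIcc (F : RegularNormalizedIFS m) (u : List (Fin m)) :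
    F.wordMap u '' Icc 0 1 ⊆ uIcc (F.wordMap u 0) (F.wordMap u 1) :=
  image_Icc_subset_uIcc (F.wordMap_continuous u).continuousOn (F.wordMap_injOn u)

/-- Injectivity strips the common initial letters. At the first letter where the words differ, the
first-level intervals are already disjoint. -/
theorem disjoint_image_wordMap (F : RegularNormalizedIFS m) (u v : List (Fin m))
    (huv : ¬ u <+: v) (hvu : ¬ v <+: u) :
    Disjoint (F.wordMap u '' Icc 0 1) (F.wordMap v '' Icc 0 1) := by
  induction u generalizing v with
  | nil => exact absurd List.nil_prefix huv
  | cons i u ih =>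
    cases v with
    | nil => exact absurd List.nil_prefix hvu
    | cons j v =>
      rw [wordMap, wordMap, image_comp, image_comp]
      by_cases hij : i = j
      · subst hij
        rw [List.prefix_cons_inj] at huv hvu
        refine disjoint_left.2 ?_
        rintro _ ⟨x, hx, rfl⟩ ⟨y, hy, hxy⟩
        rw [F.map_injOn i ((F.wordMap_mapsTo_Icc v).image_subset hy)
          ((F.wordMap_mapsTo_Icc u).image_subset hx) hxy] at hy
        exact disjoint_left.1 (ih v huv hvu) hx hy
      · exact (F.map_disjoint hij).mono (image_mono (F.wordMap_mapsTo_Icc u).image_subset)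
          (image_mono (F.wordMap_mapsTo_Icc v).image_subset)

/-- The length `|I(u)|`, as the distance of the endpoints of `I(u)`. -/
def size (F : RegularNormalizedIFS m) (u : List (Fin m)) : ℝ := |F.wordMap u 1 - F.wordMap u 0|

theorem size_nonneg (F : RegularNormalizedIFS m) (u : List (Fin m)) : 0 ≤ F.size u := abs_nonneg _

theorem size_nil (F : RegularNormalizedIFS m) : F.size [] = 1 := by simp [size, wordMap]

theorem size_le_one (F : RegularNormalizedIFS m) (u : List (Fin m)) : F.size u ≤ 1 := by
  have h0 := F.wordMap_mapsTo_Icc u (x := 0) ⟨le_rfl, zero_le_one⟩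
  have h1 := F.wordMap_mapsTo_Icc u (x := 1) ⟨zero_le_one, le_rfl⟩
  rw [size, abs_le]
  constructor <;> linarith [h0.1, h0.2, h1.1, h1.2]

theorem abs_wordMap_sub_le (F : RegularNormalizedIFS m) (u : List (Fin m)) {x y : ℝ}
    (hx : x ∈ Icc (0 : ℝ) 1) (hy : y ∈ Icc (0 : ℝ) 1) :
    |F.wordMap u x - F.wordMap u y| ≤ F.size u :=
  abs_sub_le_of_uIcc_subset_uIcc (uIcc_subset_uIcc
    (uIcc_comm (F.wordMap u 0) _ ▸ F.image_wordMap_subset_uIcc u (mem_image_of_mem _ hy))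
    (uIcc_comm (F.wordMap u 0) _ ▸ F.image_wordMap_subset_uIcc u (mem_image_of_mem _ hx))) |>.trans
    (by rw [size, abs_sub_comm])

theorem size_append_le (F : RegularNormalizedIFS m) (u v : List (Fin m)) :
    F.size (u ++ v) ≤ F.size u := by
  rw [size, wordMap_append]
  exact F.abs_wordMap_sub_le u (F.wordMap_mapsTo_Icc v ⟨zero_le_one, le_rfl⟩)
    (F.wordMap_mapsTo_Icc v ⟨le_rfl, zero_le_one⟩)

theorem size_anti (F : RegularNormalizedIFS m) {u v : List (Fin m)} (h : u <+: v) :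
    F.size v ≤ F.size u := by
  obtain ⟨w, rfl⟩ := h
  exact F.size_append_le u w

theorem diam_cylinder (F : RegularNormalizedIFS m) (u : List (Fin m)) :
    Metric.diam (F.cylinder u) = F.size u := by
  refine le_antisymm (Metric.diam_le_of_forall_dist_le (F.size_nonneg u) ?_) ?_
  · rintro _ ⟨x, hx, rfl⟩ _ ⟨y, hy, rfl⟩
    exact F.abs_wordMap_sub_le u (F.K_subset_Icc hx) (F.K_subset_Icc hy)
  · exact Metric.dist_le_diam_of_mem
      (F.isAttractor.isCompact.image (F.wordMap_continuous u)).isBounded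
      (mem_image_of_mem _ F.one_mem_K) (mem_image_of_mem _ F.zero_mem_K)

theorem cylinderHull_abs_sub_le (F : RegularNormalizedIFS m) (u : List (Fin m)) {x : ℝ}
    (hx : x ∈ F.cylinderHull u) : |x - F.wordMap u 0| ≤ F.size u := by
  have h : F.cylinderHull u ⊆ uIcc (F.wordMap u 0) (F.wordMap u 1) :=
    convexHull_min ((image_mono F.K_subset_Icc).trans (F.image_wordMap_subset_uIcc u))
      (convex_uIcc _ _)
  exact abs_sub_left_of_mem_uIcc (h hx)

theorem dim_nonneg (F : RegularNormalizedIFS m) : 0 ≤ F.dim := ENNReal.toReal_nonneg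

theorem dim_le_one (F : RegularNormalizedIFS m) : F.dim ≤ 1 := by
  refine ENNReal.toReal_le_of_le_ofReal zero_le_one ((dimH_mono (subset_univ F.K)).trans ?_)
  rw [Real.dimH_univ, ENNReal.ofReal_one]

/-! ### Bounded distortion -/

/-- The maps `f_u` are, up to the factor `D`, similarities of ratio `|I(u)|`, and neighbouring
levels are comparable. -/
structure HasBoundedGeometry (F : RegularNormalizedIFS m) (D : ℝ) : Prop where
  two_le : 2 ≤ D
  lower : ∀ u, ∀ x ∈ Icc (0 : ℝ) 1, ∀ y ∈ Icc (0 : ℝ) 1,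
    F.size u * |x - y| ≤ D * |F.wordMap u x - F.wordMap u y|
  upper : ∀ u, ∀ x ∈ Icc (0 : ℝ) 1, ∀ y ∈ Icc (0 : ℝ) 1,
    |F.wordMap u x - F.wordMap u y| ≤ D * (F.size u * |x - y|)
  child : ∀ u i, F.size u ≤ D * F.size (u ++ [i])

theorem norm_sub_le_of_deriv_le {f : ℝ → ℝ} (hf : Differentiable ℝ f) {C : ℝ}
    (hC : ∀ x ∈ Icc (0 : ℝ) 1, |deriv f x| ≤ C) {x y : ℝ} (hx : x ∈ Icc (0 : ℝ) 1)
    (hy : y ∈ Icc (0 : ℝ) 1) : |f x - f y| ≤ C * |x - y| :=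
  (convex_Icc (0 : ℝ) 1).norm_image_sub_le_of_norm_deriv_le (fun z _ => hf z) hC hy hx

theorem exists_abs_sub_eq_deriv_mul {f : ℝ → ℝ} (hf : Differentiable ℝ f) {x y : ℝ}
    (hx : x ∈ Icc (0 : ℝ) 1) (hy : y ∈ Icc (0 : ℝ) 1) :
    ∃ z ∈ Icc (0 : ℝ) 1, |f x - f y| = |deriv f z| * |x - y| := by
  wlog hxy : x < y generalizing x y
  · rcases (not_lt.1 hxy).eq_or_lt with h | h
    · exact ⟨x, hx, by simp [h]⟩
    · obtain ⟨z, hz, h'⟩ := this hy hx h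
      exact ⟨z, hz, by rw [abs_sub_comm, h', abs_sub_comm]⟩
  obtain ⟨z, hz, h⟩ := exists_deriv_eq_slope f hxy hf.continuous.continuousOn
    hf.differentiableOn
  refine ⟨z, ⟨hx.1.trans hz.1.le, hz.2.le.trans hy.2⟩, ?_⟩
  rw [h, abs_sub_comm (f x), abs_sub_comm x, ← abs_mul, div_mul_cancel₀ _ (sub_pos.2 hxy).ne']

/-- Bounded distortion. -/
theorem hasBoundedGeometry_of_deriv_bounds (F : RegularNormalizedIFS m) {a B L : ℝ} (ha : 0 < a)
    (hB : 0 ≤ B) (hL : L < 1) (hL0 : 0 ≤ L)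
    (hlow : ∀ i, ∀ x ∈ Icc (0 : ℝ) 1, a ≤ |deriv (F.map i) x|)
    (hup : ∀ i, ∀ x ∈ Icc (0 : ℝ) 1, |deriv (F.map i) x| ≤ L)
    (hsec : ∀ i, ∀ x ∈ Icc (0 : ℝ) 1, |deriv (deriv (F.map i)) x| ≤ B) :
    F.HasBoundedGeometry
      (2 + Real.exp (B / a / (1 - L)) + Real.exp (B / a / (1 - L)) / a) := by
  -- A bound for `|f_i''| / |f_i'|`, that is, a Lipschitz constant for `log |f_i'|`.
  set M := B / a with hM
  have hM0 : 0 ≤ M := by positivity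
  set E := Real.exp (M / (1 - L)) with hE
  have hE0 : 0 < E := Real.exp_pos _
  have hdiff : ∀ i, Differentiable ℝ (F.map i) := fun i =>
    (F.isC2IFS.contDiff i).differentiable (by norm_num)
  have hdiff2 : ∀ i, Differentiable ℝ (deriv (F.map i)) := fun i =>
    (F.isC2IFS.contDiff i).differentiable_deriv_two
  have hstep : ∀ i, ∀ x ∈ Icc (0 : ℝ) 1, ∀ y ∈ Icc (0 : ℝ) 1,
      |deriv (F.map i) x| ≤ |deriv (F.map i) y| * Real.exp (M * |x - y|) := by
    intro i x hx y hy
    have h1 := norm_sub_le_of_deriv_le (hdiff2 i) (hsec i) hx hy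
    have h2 : B * |x - y| ≤ |deriv (F.map i) y| * (M * |x - y|) := by
      have : B = a * M := by rw [hM]; field_simp
      rw [this, mul_assoc]
      exact mul_le_mul_of_nonneg_right (hlow i y hy) (by positivity)
    have h3 := mul_le_mul_of_nonneg_left (Real.add_one_le_exp (M * |x - y|))
      (abs_nonneg (deriv (F.map i) y))
    have h4 := abs_sub_abs_le_abs_sub (deriv (F.map i) x) (deriv (F.map i) y)
    linarith
  have hcontr : ∀ u : List (Fin m), ∀ x ∈ Icc (0 : ℝ) 1, ∀ y ∈ Icc (0 : ℝ) 1,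
      |F.wordMap u x - F.wordMap u y| ≤ L ^ u.length * |x - y| := by
    intro u x hx y hy
    induction u with
    | nil => simp [wordMap]
    | cons i u ih =>
      have h1 := norm_sub_le_of_deriv_le (hdiff i) (hup i) (F.wordMap_mapsTo_Icc u hx)
        (F.wordMap_mapsTo_Icc u hy)
      refine h1.trans ?_
      rw [List.length_cons, pow_succ', mul_assoc]
      exact mul_le_mul_of_nonneg_left ih hL0
  -- In the chain rule for `i :: u`, the factor `f_i'` is evaluated at two points at distance at
  -- most `L ^ u.length`; the resulting exponents add up to a geometric sum.
  have hgeom : ∀ u : List (Fin m), ∀ x ∈ Icc (0 : ℝ) 1, ∀ y ∈ Icc (0 : ℝ) 1,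
      |deriv (F.wordMap u) x| ≤ |deriv (F.wordMap u) y| *
        Real.exp (M * ∑ k ∈ Finset.range u.length, L ^ k) := by
    intro u x hx y hy
    induction u with
    | nil => simp [wordMap]
    | cons i u ih =>
      have hd : ∀ z, deriv (F.wordMap (i :: u)) z =
          deriv (F.map i) (F.wordMap u z) * deriv (F.wordMap u) z := fun z =>
        deriv_comp z (hdiff i _) (F.wordMap_differentiable u z)
      have h1 := hstep i _ (F.wordMap_mapsTo_Icc u hx) _ (F.wordMap_mapsTo_Icc u hy)
      have h2 : |F.wordMap u x - F.wordMap u y| ≤ L ^ u.length := by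
        refine (hcontr u x hx y hy).trans (mul_le_of_le_one_right (by positivity) ?_)
        rw [abs_le]
        constructor <;> linarith [hx.1, hx.2, hy.1, hy.2]
      have h3 : |deriv (F.map i) (F.wordMap u x)| ≤
          |deriv (F.map i) (F.wordMap u y)| * Real.exp (M * L ^ u.length) :=
        h1.trans (mul_le_mul_of_nonneg_left
          (Real.exp_le_exp.2 (mul_le_mul_of_nonneg_left h2 hM0)) (abs_nonneg _))
      rw [hd, hd, abs_mul, abs_mul, List.length_cons, Finset.sum_range_succ, mul_add, Real.exp_add]
      calc _ ≤ _ := mul_le_mul h3 ih (abs_nonneg _) (by positivity)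
        _ = _ := by ring
  have hdist : ∀ u : List (Fin m), ∀ x ∈ Icc (0 : ℝ) 1, ∀ y ∈ Icc (0 : ℝ) 1,
      |deriv (F.wordMap u) x| ≤ |deriv (F.wordMap u) y| * E := by
    intro u x hx y hy
    refine (hgeom u x hx y hy).trans (mul_le_mul_of_nonneg_left (Real.exp_le_exp.2 ?_)
      (abs_nonneg _))
    rw [div_eq_mul_inv]
    refine mul_le_mul_of_nonneg_left ?_ hM0
    rw [← tsum_geometric_of_lt_one hL0 hL]
    exact (summable_geometric_of_lt_one hL0 hL).sum_le_tsum _ fun k _ => by positivity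
  have h0 : (0 : ℝ) ∈ Icc (0 : ℝ) 1 := ⟨le_rfl, zero_le_one⟩
  have h1 : (1 : ℝ) ∈ Icc (0 : ℝ) 1 := ⟨zero_le_one, le_rfl⟩
  have hlower : ∀ u, ∀ x ∈ Icc (0 : ℝ) 1, ∀ y ∈ Icc (0 : ℝ) 1,
      F.size u * |x - y| ≤ E * |F.wordMap u x - F.wordMap u y| := by
    intro u x hx y hy
    obtain ⟨z, hz, hz'⟩ := exists_abs_sub_eq_deriv_mul (F.wordMap_differentiable u) hx hy
    obtain ⟨w, hw, hw'⟩ := exists_abs_sub_eq_deriv_mul (F.wordMap_differentiable u) h1 h0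
    rw [size, hw', hz', sub_zero, abs_one, mul_one, ← mul_assoc, mul_comm E]
    exact mul_le_mul_of_nonneg_right (hdist u w hw z hz) (abs_nonneg _)
  have hupper : ∀ u, ∀ x ∈ Icc (0 : ℝ) 1, ∀ y ∈ Icc (0 : ℝ) 1,
      |F.wordMap u x - F.wordMap u y| ≤ E * (F.size u * |x - y|) := by
    intro u x hx y hy
    obtain ⟨z, hz, hz'⟩ := exists_abs_sub_eq_deriv_mul (F.wordMap_differentiable u) hx hy
    obtain ⟨w, hw, hw'⟩ := exists_abs_sub_eq_deriv_mul (F.wordMap_differentiable u) h1 h0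
    rw [size, hw', hz', sub_zero, abs_one, mul_one, ← mul_assoc, mul_comm E]
    exact mul_le_mul_of_nonneg_right (hdist u z hz w hw) (abs_nonneg _)
  have hEa : 0 ≤ E / a := by positivity
  -- The summands of the constant serve different clauses: `2` for `two_le`, `E` for the two
  -- distance estimates, `E / a` for `child`.
  refine ⟨by linarith, fun u x hx y hy => (hlower u x hx y hy).trans ?_,
    fun u x hx y hy => (hupper u x hx y hy).trans ?_, fun u i => ?_⟩
  · exact mul_le_mul_of_nonneg_right (by linarith) (abs_nonneg _)
  · exact mul_le_mul_of_nonneg_right (by linarith)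
      (mul_nonneg (F.size_nonneg u) (abs_nonneg _))
  · obtain ⟨w, hw, hw'⟩ := exists_abs_sub_eq_deriv_mul (hdiff i) h1 h0
    have h2 := hlower u _ (F.map_mapsTo_Icc i h1) _ (F.map_mapsTo_Icc i h0)
    have h3 : F.size (u ++ [i]) = |F.wordMap u (F.map i 1) - F.wordMap u (F.map i 0)| := by
      rw [size, wordMap_append]; rfl
    rw [← h3, hw', sub_zero, abs_one, mul_one] at h2
    have h4 : F.size u * a ≤ E * F.size (u ++ [i]) :=
      (mul_le_mul_of_nonneg_left (hlow i w hw) (F.size_nonneg u)).trans h2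
    have h5 : F.size u ≤ E / a * F.size (u ++ [i]) := by
      rw [div_mul_eq_mul_div, le_div_iff₀ ha]; exact h4
    refine h5.trans (mul_le_mul_of_nonneg_right (by linarith) (F.size_nonneg _))

/-- Bounded geometry holds locally uniformly in the `C²` topology. -/
theorem eventually_hasBoundedGeometry (F₀ : RegularNormalizedIFS m) :
    ∃ D, ∀ᶠ F in 𝓝 F₀, F.HasBoundedGeometry D := by
  have hne : (Icc (0 : ℝ) 1).Nonempty := nonempty_Icc.2 zero_le_one
  obtain ⟨a, hlow, ha⟩ : ∃ a : ℝ, (∀ i, ∀ x ∈ Icc (0 : ℝ) 1, a ≤ |deriv (F₀.map i) x|) ∧ 0 < a := by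
    refine Eventually.exists (f := 𝓝[>] (0 : ℝ)) (Eventually.and ?_ self_mem_nhdsWithin)
    rw [eventually_all]
    intro i
    have hc : ContinuousOn (fun x => |deriv (F₀.map i) x|) (Icc 0 1) :=
      ((F₀.isC2IFS.contDiff i).continuous_deriv (by norm_num)).abs.continuousOn
    obtain ⟨x, hx, hmin⟩ := isCompact_Icc.exists_isMinOn hne hc
    have hpos : 0 < |deriv (F₀.map i) x| :=
      abs_pos.2 (F₀.isRegular.deriv_ne_zero i x (by rw [F₀.normalized]; exact hx))
    filter_upwards [Ioo_mem_nhdsGT hpos] with a ha y hy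
    exact ha.2.le.trans (hmin hy)
  obtain ⟨B, hsec, hB⟩ : ∃ B : ℝ, (∀ i, ∀ x ∈ Icc (0 : ℝ) 1, |deriv (deriv (F₀.map i)) x| ≤ B) ∧
      0 ≤ B := by
    refine Eventually.exists (f := atTop) (Eventually.and ?_ (eventually_ge_atTop 0))
    rw [eventually_all]
    intro i
    have hc : ContinuousOn (fun x => |deriv (deriv (F₀.map i)) x|) (Icc 0 1) := by
      have := (F₀.isC2IFS.contDiff i).continuous_iteratedDeriv 2 le_rfl
      rw [iteratedDeriv_succ, iteratedDeriv_one] at this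
      exact this.abs.continuousOn
    obtain ⟨x, hx, hmax⟩ := isCompact_Icc.exists_isMaxOn hne hc
    filter_upwards [eventually_ge_atTop |deriv (deriv (F₀.map i)) x|] with B hB y hy
    exact (hmax hy).trans hB
  obtain ⟨L, hL0, hL, hup⟩ : ∃ L : ℝ, 0 ≤ L ∧ L < 1 ∧ ∀ i x, |deriv (F₀.map i) x| ≤ L := by
    obtain ⟨L, hL, hLip⟩ := F₀.isC2IFS.contracting
    refine ⟨max L 0, le_max_right _ _, max_lt hL one_pos, fun i x => ?_⟩
    have := norm_deriv_le_of_lipschitz (f := F₀.map i) (x₀ := x) (C := L.toNNReal)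
      (LipschitzWith.of_dist_le_mul fun x y => (hLip i x y).trans
        (mul_le_mul_of_nonneg_right (Real.le_coe_toNNReal L) (abs_nonneg _)))
    simpa [Real.norm_eq_abs] using this
  -- Such a perturbation keeps the derivatives between `a / 2` and `(1 + L) / 2 < 1` in absolute
  -- value.
  set ε := min (a / 2) ((1 - L) / 2) with hε
  have hε0 : 0 < ε := lt_min (by linarith) (by linarith)
  have hεa : ε ≤ a / 2 := min_le_left _ _
  have hεL : ε ≤ (1 - L) / 2 := min_le_right _ _
  refine ⟨2 + Real.exp ((B + ε) / (a / 2) / (1 - (1 + L) / 2)) +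
    Real.exp ((B + ε) / (a / 2) / (1 - (1 + L) / 2)) / (a / 2), ?_⟩
  have hcont : Continuous (jet : RegularNormalizedIFS m → _) := continuous_induced_dom
  filter_upwards [hcont.continuousAt.eventually (Metric.ball_mem_nhds (jet F₀) hε0)] with F hF
  have hF' : ∀ i (k : Fin 3), ∀ x ∈ Icc (0 : ℝ) 1,
      |iteratedDeriv (k : ℕ) (F.map i) x - iteratedDeriv (k : ℕ) (F₀.map i) x| ≤ ε := by
    intro i k x hx
    have h1 : dist (jet F) (jet F₀) < ε := hF
    have h2 := ContinuousMap.dist_apply_le_dist (f := jet F i k) (g := jet F₀ i k) ⟨x, hx⟩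
    exact h2.trans ((dist_le_pi_dist (jet F i) (jet F₀ i) k).trans
      ((dist_le_pi_dist (jet F) (jet F₀) i).trans h1.le))
  have hF1 : ∀ i, ∀ x ∈ Icc (0 : ℝ) 1, |deriv (F.map i) x - deriv (F₀.map i) x| ≤ ε := by
    intro i x hx
    have := hF' i 1 x hx
    simpa using this
  have hF2 : ∀ i, ∀ x ∈ Icc (0 : ℝ) 1,
      |deriv (deriv (F.map i)) x - deriv (deriv (F₀.map i)) x| ≤ ε := by
    intro i x hx
    have := hF' i 2 x hx
    simpa [iteratedDeriv_succ] using this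
  refine F.hasBoundedGeometry_of_deriv_bounds (a := a / 2) (B := B + ε) (L := (1 + L) / 2)
    (by linarith) (by linarith) (by linarith) (by linarith) ?_ ?_ ?_
  · intro i x hx
    have h1 := abs_sub_abs_le_abs_sub (deriv (F₀.map i) x) (deriv (F.map i) x)
    rw [abs_sub_comm] at h1
    linarith [hlow i x hx, hF1 i x hx]
  · intro i x hx
    linarith [abs_sub_abs_le_abs_sub (deriv (F.map i) x) (deriv (F₀.map i) x), hup i x,
      hF1 i x hx]
  · intro i x hx
    linarith [abs_sub_abs_le_abs_sub (deriv (deriv (F.map i)) x) (deriv (deriv (F₀.map i)) x),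
      hsec i x hx, hF2 i x hx]

/-! ### Counting cylinders -/

theorem HasBoundedGeometry.size_append_le {F : RegularNormalizedIFS m} {D : ℝ}
    (h : F.HasBoundedGeometry D) (u v : List (Fin m)) :
    F.size (u ++ v) ≤ D * (F.size u * F.size v) := by
  have := h.upper u _ (F.wordMap_mapsTo_Icc v ⟨zero_le_one, le_rfl⟩) _
    (F.wordMap_mapsTo_Icc v ⟨le_rfl, zero_le_one⟩)
  rwa [size, wordMap_append]

theorem IsScaleWord.lt_size {F : RegularNormalizedIFS m} {ρ : ℝ} {u : List (Fin m)}
    (h : F.IsScaleWord ρ u) : ρ < F.size u := by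
  rw [← F.diam_cylinder]; exact h.1

theorem IsScaleWord.eq_of_prefix {F : RegularNormalizedIFS m} {ρ : ℝ} {u v : List (Fin m)}
    (hu : F.IsScaleWord ρ u) (hv : F.IsScaleWord ρ v) (h : u <+: v) : u = v := by
  by_contra hne
  exact hu.2 v h (Ne.symm hne) hv.1

/-- A one-letter extension has size at most `ρ` and is comparable to its parent. The alphabet is
nonempty because `K` is. -/
theorem IsScaleWord.size_le {F : RegularNormalizedIFS m} {D : ℝ} (hD : F.HasBoundedGeometry D)
    {ρ : ℝ} {u : List (Fin m)} (h : F.IsScaleWord ρ u) : F.size u ≤ D * ρ := by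
  have hne : F.K.Nonempty := F.isAttractor.nonempty
  rw [F.isAttractor.eq_iUnion] at hne
  obtain ⟨_, hx⟩ := hne
  obtain ⟨i, -⟩ := mem_iUnion.1 hx
  have h1 := h.2 (u ++ [i]) (List.prefix_append u [i]) (by simp)
  rw [F.diam_cylinder, not_lt] at h1
  exact (hD.child u i).trans (mul_le_mul_of_nonneg_left h1 (by linarith [hD.two_le]))

/-- An antichain of words with cylinders of length at least `r` has at most `(D / r) ^ dim K`
elements. -/
theorem HasBoundedGeometry.card_le {F : RegularNormalizedIFS m} {D : ℝ}
    (hD : F.HasBoundedGeometry D) (W : Finset (List (Fin m)))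
    (hanti : ∀ u ∈ W, ∀ v ∈ W, u <+: v → u = v) {r : ℝ} (hr : 0 < r)
    (hsize : ∀ u ∈ W, r ≤ F.size u) : (W.card : ℝ) ≤ (D / r) ^ F.dim := by
  have hD2 := hD.two_le
  rcases W.eq_empty_or_nonempty with rfl | ⟨w, hw⟩
  · simp only [Finset.card_empty, Nat.cast_zero]; positivity
  have hr1 : r ≤ 1 := (hsize w hw).trans (F.size_le_one w)
  have hq1 : r / D < 1 := by rw [div_lt_one (by linarith)]; linarith
  -- The digit coding needs base at least `2`; one word is harmless, since `D / r ≥ 1`.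
  rcases Nat.lt_or_ge W.card 2 with hW | hW
  · have h1 : (W.card : ℝ) ≤ 1 := by exact_mod_cast Nat.lt_succ_iff.1 hW
    refine h1.trans (Real.one_le_rpow ?_ F.dim_nonneg)
    rw [le_div_iff₀ hr]; linarith
  let e := W.equivFin.symm
  have key := natCast_le_rpow_dimH F.isAttractor.isCompact F.isAttractor.nonempty hW
    (fun j => F.wordMap (e j)) (fun j => F.wordMap_continuous _)
    (fun j => F.wordMap_mapsTo_K _) (fun i j hij => by
      have hne : ((e i : W) : List (Fin m)) ≠ e j := fun h => hij (e.injective (Subtype.ext h))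
      exact (F.disjoint_image_wordMap _ _
        (fun h => hne (hanti _ (e i).2 _ (e j).2 h))
        (fun h => hne (hanti _ (e j).2 _ (e i).2 h).symm)).mono
          (image_mono F.K_subset_Icc) (image_mono F.K_subset_Icc))
    (q := r / D) (by positivity) hq1 (fun j x hx y hy => by
      have h1 := hD.lower (e j) x (F.K_subset_Icc hx) y (F.K_subset_Icc hy)
      rw [div_mul_eq_mul_div, div_le_iff₀ (by linarith), mul_comm _ D]
      exact (mul_le_mul_of_nonneg_right (hsize _ (e j).2) (abs_nonneg _)).trans h1)
  rwa [one_div_div] at key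

/-- The number of pairwise disjoint cylinders longer than `t` inside an interval. -/
theorem card_mul_le_of_subset_Icc (F : RegularNormalizedIFS m) (W : Finset (List (Fin m)))
    (hanti : ∀ u ∈ W, ∀ v ∈ W, u <+: v → u = v) {t b c : ℝ} (hbc : b ≤ c)
    (hsize : ∀ u ∈ W, t ≤ F.size u) (hsub : ∀ u ∈ W, F.wordMap u '' Icc 0 1 ⊆ Icc b c) :
    W.card * t ≤ c - b := by
  have hvol : ∀ u ∈ W, ENNReal.ofReal t ≤ volume (F.wordMap u '' Icc 0 1) := by
    intro u hu
    refine (ENNReal.ofReal_le_ofReal (hsize u hu)).trans ?_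
    rw [size, ← Real.volume_interval]
    refine measure_mono ?_
    have := intermediate_value_uIcc (a := (0 : ℝ)) (b := 1) (F.wordMap_continuous u).continuousOn
    rwa [uIcc_of_le zero_le_one] at this
  have hdisj : (W : Set (List (Fin m))).PairwiseDisjoint fun u => F.wordMap u '' Icc 0 1 :=
    fun u hu v hv huv => F.disjoint_image_wordMap u v (fun h => huv (hanti u hu v hv h))
      (fun h => huv (hanti v hv u hu h).symm)
  have h1 : (W.card : ENNReal) * ENNReal.ofReal t ≤ ENNReal.ofReal (c - b) := by
    calc (W.card : ENNReal) * ENNReal.ofReal t = ∑ u ∈ W, ENNReal.ofReal t := by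
          rw [Finset.sum_const, nsmul_eq_mul]
      _ ≤ ∑ u ∈ W, volume (F.wordMap u '' Icc 0 1) := Finset.sum_le_sum hvol
      _ = volume (⋃ u ∈ W, F.wordMap u '' Icc 0 1) :=
          (measure_biUnion_finset hdisj fun u _ =>
            (isCompact_Icc.image (F.wordMap_continuous u)).measurableSet).symm
      _ ≤ volume (Icc b c) := measure_mono (iUnion₂_subset hsub)
      _ = ENNReal.ofReal (c - b) := Real.volume_Icc
  rwa [← ENNReal.ofReal_natCast, ← ENNReal.ofReal_mul (by positivity),
    ENNReal.ofReal_le_ofReal_iff (by linarith)] at h1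

/-- A word with a short cylinder has a first prefix with a short cylinder. -/
theorem exists_first_prefix (F : RegularNormalizedIFS m) {T : ℝ} (hT : T < 1) (u : List (Fin m))
    (hu : F.size u ≤ T) : ∃ w i, w ++ [i] <+: u ∧ T < F.size w ∧ F.size (w ++ [i]) ≤ T := by
  induction u using List.reverseRecOn with
  | nil => rw [size_nil] at hu; linarith
  | append_singleton u i ih =>
    by_cases h : F.size u ≤ T
    · obtain ⟨w, j, h1, h2⟩ := ih h
      exact ⟨w, j, h1.trans (List.prefix_append _ _), h2⟩
    · exact ⟨u, i, List.prefix_rfl, not_le.1 h, hu⟩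

theorem prefix_of_prefix_concat_of_ne {α : Type*} {u v : List α} {j : α} (h : u <+: v ++ [j])
    (hne : u ≠ v ++ [j]) : u <+: v :=
  (List.prefix_concat_iff.1 h).resolve_left hne

/-- The number of scale words with cylinders near a given point. -/
theorem HasBoundedGeometry.card_near_le {F : RegularNormalizedIFS m} {D : ℝ}
    (hD : F.HasBoundedGeometry D) {ρ t x : ℝ} (hρ : 0 < ρ) (ht : ρ ≤ t)
    (S : Finset (List (Fin m))) (hS : ∀ u ∈ S, F.IsScaleWord ρ u)
    (hnear : ∀ u ∈ S, |F.wordMap u 0 - x| ≤ t) :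
    (S.card : ℝ) ≤ 3 * D ^ 4 * (t / ρ) ^ F.dim := by
  classical
  have hD2 := hD.two_le
  have hD0 : 0 < D := by linarith
  have ht0 : 0 < t := hρ.trans_le ht
  have hd0 := F.dim_nonneg
  have hd1 := F.dim_le_one
  have hpow : ∀ c : ℝ, 1 ≤ c → (c * (t / ρ)) ^ F.dim ≤ c * (t / ρ) ^ F.dim := by
    intro c hc
    rw [Real.mul_rpow (by linarith) (by positivity)]
    exact mul_le_mul_of_nonneg_right (Real.rpow_le_self_of_one_le hc hd1) (by positivity)
  have hanti : ∀ u ∈ S, ∀ v ∈ S, u <+: v → u = v := fun u hu v hv h =>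
    (hS u hu).eq_of_prefix (hS v hv) h
  -- At scales comparable to the whole interval the global count suffices. Otherwise each word is
  -- cut at its first prefix of size at most `D * t`, whose size then lies in `[t, D * t]`.
  rcases le_or_gt 1 (D * t) with hDt | hDt
  · have h1 := hD.card_le S hanti hρ fun u hu => (hS u hu).lt_size.le
    have h2 : D / ρ ≤ D ^ 2 * (t / ρ) := by
      rw [mul_div_assoc', div_le_div_iff_of_pos_right hρ]; nlinarith
    calc (S.card : ℝ) ≤ (D / ρ) ^ F.dim := h1
      _ ≤ (D ^ 2 * (t / ρ)) ^ F.dim := Real.rpow_le_rpow (by positivity) h2 hd0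
      _ ≤ D ^ 2 * (t / ρ) ^ F.dim := hpow _ (by nlinarith)
      _ ≤ _ := mul_le_mul_of_nonneg_right
          (by linarith [pow_le_pow_right₀ (show 1 ≤ D by linarith) (show 2 ≤ 4 by norm_num), pow_pos hD0 4]) (by positivity)
  have hex : ∀ u, ∃ p : List (Fin m) × Fin m, u ∈ S → p.1 ++ [p.2] <+: u ∧ D * t < F.size p.1 ∧
      F.size (p.1 ++ [p.2]) ≤ D * t := by
    intro u
    by_cases hu : u ∈ S
    · obtain ⟨w, i, h⟩ := F.exists_first_prefix hDt u (((hS u hu).size_le hD).trans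
        (mul_le_mul_of_nonneg_left ht hD0.le))
      exact ⟨(w, i), fun _ => h⟩
    · obtain ⟨_, hx⟩ := F.isAttractor.eq_iUnion ▸ F.isAttractor.nonempty
      obtain ⟨i, -⟩ := mem_iUnion.1 hx
      exact ⟨([], i), fun h => absurd h hu⟩
  choose p hp using hex
  let cut : List (Fin m) → List (Fin m) := fun u => (p u).1 ++ [(p u).2]
  let W := S.image cut
  have hWsize : ∀ w ∈ W, t ≤ F.size w ∧ F.size w ≤ D * t := by
    intro w hw
    obtain ⟨u, hu, rfl⟩ := Finset.mem_image.1 hw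
    obtain ⟨-, h1, h2⟩ := hp u hu
    refine ⟨?_, h2⟩
    have h3 := h1.le.trans (hD.child (p u).1 (p u).2)
    exact le_of_mul_le_mul_left h3 hD0
  have hWanti : ∀ w ∈ W, ∀ v ∈ W, w <+: v → w = v := by
    intro w hw v hv h
    by_contra hne
    obtain ⟨u, hu, rfl⟩ := Finset.mem_image.1 hv
    have h1 := F.size_anti (prefix_of_prefix_concat_of_ne h hne)
    linarith [(hp u hu).2.1, (hWsize w hw).2]
  -- The cut cylinders are disjoint, have length at least `t`, and lie in an interval of length `2 *
  -- (t + D * t) ≤ 3 * D * t`.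
  have hWcard : (W.card : ℝ) ≤ 3 * D := by
    have h1 := F.card_mul_le_of_subset_Icc W hWanti
      (b := x - (t + D * t)) (c := x + (t + D * t)) (by nlinarith) (fun w hw => (hWsize w hw).1) (by
        intro w hw
        have hw2 := (hWsize w hw).2
        obtain ⟨u, hu, rfl⟩ := Finset.mem_image.1 hw
        obtain ⟨v, hv⟩ := (hp u hu).1
        have h2 := hnear u hu
        rw [← hv, wordMap_append] at h2
        rintro _ ⟨y, hy, rfl⟩
        have h3 := (F.abs_wordMap_sub_le (cut u) hy
          (F.wordMap_mapsTo_Icc v (x := 0) ⟨le_rfl, zero_le_one⟩)).trans hw2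
        rw [Function.comp, abs_le] at h2
        rw [abs_le] at h3
        constructor <;> linarith [h2.1, h2.2, h3.1, h3.2])
    have h2 : (W.card : ℝ) * t ≤ (3 * D) * t := by nlinarith
    exact le_of_mul_le_mul_right h2 ht0
  -- The tails after a fixed cut `w` form an antichain, and `size_append_le` bounds their sizes
  -- below by `ρ / (D ^ 2 * t)`.
  have hfiber : ∀ w ∈ W, ((S.filter fun u => cut u = w).card : ℝ) ≤ D ^ 3 * (t / ρ) ^ F.dim := by
    intro w hw
    have hpre : ∀ u ∈ S.filter fun u => cut u = w, w ++ u.drop w.length = u := by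
      intro u hu
      obtain ⟨hu, hw'⟩ := Finset.mem_filter.1 hu
      have h := (hp u hu).1
      change cut u <+: u at h
      rw [hw'] at h
      exact List.prefix_append_drop h |>.symm
    set V := (S.filter fun u => cut u = w).image fun u => u.drop w.length with hV
    have hcard : V.card = (S.filter fun u => cut u = w).card := by
      refine Finset.card_image_of_injOn fun u hu v hv huv => ?_
      rw [← hpre u hu, ← hpre v hv]
      exact congrArg (w ++ ·) huv
    have hVanti : ∀ a ∈ V, ∀ b ∈ V, a <+: b → a = b := by
      intro a ha b hb hab
      obtain ⟨u, hu, rfl⟩ := Finset.mem_image.1 ha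
      obtain ⟨v, hv, rfl⟩ := Finset.mem_image.1 hb
      have h := hanti u (Finset.mem_filter.1 hu).1 v (Finset.mem_filter.1 hv).1 (by
        rw [← hpre u hu, ← hpre v hv]
        exact (List.prefix_append_right_inj w).2 hab)
      rw [h]
    have hVsize : ∀ a ∈ V, ρ / (D ^ 2 * t) ≤ F.size a := by
      intro a ha
      obtain ⟨u, hu, rfl⟩ := Finset.mem_image.1 ha
      have h1 := (hS u (Finset.mem_filter.1 hu).1).lt_size
      have h2 := hD.size_append_le w (u.drop w.length)
      rw [hpre u hu] at h2
      have h3 : F.size w * F.size (u.drop w.length) ≤ D * t * F.size (u.drop w.length) :=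
        mul_le_mul_of_nonneg_right (hWsize w hw).2 (F.size_nonneg _)
      have h4 := mul_le_mul_of_nonneg_left h3 hD0.le
      rw [div_le_iff₀ (by positivity)]
      linarith
    rw [← hcard]
    refine (hD.card_le V hVanti (by positivity) hVsize).trans ?_
    rw [show D / (ρ / (D ^ 2 * t)) = D ^ 3 * (t / ρ) by field_simp]
    exact hpow _ (one_le_pow₀ (by linarith))
  calc (S.card : ℝ) = ∑ w ∈ W, ((S.filter fun u => cut u = w).card : ℝ) := by
        rw [Finset.card_eq_sum_card_image cut S, Nat.cast_sum]
    _ ≤ ∑ w ∈ W, D ^ 3 * (t / ρ) ^ F.dim := Finset.sum_le_sum hfiber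
    _ = W.card * (D ^ 3 * (t / ρ) ^ F.dim) := by rw [Finset.sum_const, nsmul_eq_mul]
    _ ≤ 3 * D * (D ^ 3 * (t / ρ) ^ F.dim) := mul_le_mul_of_nonneg_right hWcard (by positivity)
    _ = _ := by ring

end RegularNormalizedIFS

theorem RegularNormalizedIFS.HasBoundedGeometry.mono {m : ℕ} {F : RegularNormalizedIFS m}
    {D D' : ℝ} (h : F.HasBoundedGeometry D) (hD : D ≤ D') : F.HasBoundedGeometry D' where
  two_le := h.two_le.trans hD
  lower u x hx y hy := (h.lower u x hx y hy).trans
    (mul_le_mul_of_nonneg_right hD (abs_nonneg _))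
  upper u x hx y hy := (h.upper u x hx y hy).trans
    (mul_le_mul_of_nonneg_right hD (mul_nonneg (F.size_nonneg u) (abs_nonneg _)))
  child u i := (h.child u i).trans (mul_le_mul_of_nonneg_right hD (F.size_nonneg _))

/-! ### Transversality and near pairs -/

/-- The parameters `l` for which the base points of the rectangles `Q(u)` and `Q(v)` have
projections at distance at most `c`. -/
def nearParameters (F₁ : RegularNormalizedIFS m₁) (F₂ : RegularNormalizedIFS m₂) (c : ℝ)
    (u v : List (Fin m₁) × List (Fin m₂)) : Set ℝ :=
  {l | |F₁.wordMap u.1 0 - F₁.wordMap v.1 0 + l * (F₂.wordMap u.2 0 - F₂.wordMap v.2 0)| ≤ c}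

variable {F₁ : RegularNormalizedIFS m₁} {F₂ : RegularNormalizedIFS m₂} {D ρ A c : ℝ}

theorem nearParameters_symm {u v : List (Fin m₁) × List (Fin m₂)} {l : ℝ}
    (h : l ∈ nearParameters F₁ F₂ c u v) : l ∈ nearParameters F₁ F₂ c v u := by
  rw [nearParameters, mem_ofPred_eq, ← abs_neg]
  refine le_of_eq_of_le (congrArg _ ?_) h
  ring

theorem mem_nearParameters_self (hc : 0 ≤ c) (u : List (Fin m₁) × List (Fin m₂)) (l : ℝ) :
    l ∈ nearParameters F₁ F₂ c u u := by
  simpa [nearParameters] using hc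

theorem isClosed_nearParameters (u v : List (Fin m₁) × List (Fin m₂)) :
    IsClosed (nearParameters F₁ F₂ c u v) :=
  isClosed_le (by fun_prop) continuous_const

/-- Each side of a rectangle has length at most `D * ρ`, so a projected point is within `D * ρ * (1
+ A)` of the projected base point; two rectangles double this. -/
theorem mem_nearParameters_of_not_disjoint (h₁ : F₁.HasBoundedGeometry D)
    (h₂ : F₂.HasBoundedGeometry D) (hρ : 0 < ρ) (hc : 2 * D * (1 + A) ≤ c)
    {u v : List (Fin m₁) × List (Fin m₂)} (hu : u ∈ rhoDecomposition F₁ F₂ ρ)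
    (hv : v ∈ rhoDecomposition F₁ F₂ ρ) {l : ℝ} (hl : l ∈ Icc (-A) A)
    (h : ¬ Disjoint (proj l '' rect F₁ F₂ (id, id) u) (proj l '' rect F₁ F₂ (id, id) v)) :
    l ∈ nearParameters F₁ F₂ (c * ρ) u v := by
  obtain ⟨_, ⟨⟨x, y⟩, hxy, rfl⟩, ⟨⟨x', y'⟩, hxy', hp⟩⟩ := not_disjoint_iff.1 h
  simp only [rect, image_id, mem_prod] at hxy hxy'
  have e1 := (F₁.cylinderHull_abs_sub_le _ hxy.1).trans (hu.1.size_le h₁)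
  have e2 := (F₂.cylinderHull_abs_sub_le _ hxy.2).trans (hu.2.size_le h₂)
  have e3 := (F₁.cylinderHull_abs_sub_le _ hxy'.1).trans (hv.1.size_le h₁)
  have e4 := (F₂.cylinderHull_abs_sub_le _ hxy'.2).trans (hv.2.size_le h₂)
  simp only [proj] at hp
  have hlA : |l| ≤ A := abs_le.2 hl
  have hDρ : 0 ≤ D * ρ := (abs_nonneg _).trans e1
  have key : F₁.wordMap u.1 0 - F₁.wordMap v.1 0 + l * (F₂.wordMap u.2 0 - F₂.wordMap v.2 0) =
      ((x' - F₁.wordMap v.1 0) - (x - F₁.wordMap u.1 0)) +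
        l * ((y' - F₂.wordMap v.2 0) - (y - F₂.wordMap u.2 0)) := by linarith
  have g1 := abs_sub (x' - F₁.wordMap v.1 0) (x - F₁.wordMap u.1 0)
  have g2 := abs_sub (y' - F₂.wordMap v.2 0) (y - F₂.wordMap u.2 0)
  have g3 : |l * ((y' - F₂.wordMap v.2 0) - (y - F₂.wordMap u.2 0))| ≤ A * (2 * (D * ρ)) := by
    rw [abs_mul]
    exact mul_le_mul hlA (by linarith) (abs_nonneg _) ((abs_nonneg _).trans hlA)
  rw [nearParameters, mem_ofPred_eq, key]
  refine (abs_add_le _ _).trans (le_trans ?_ (mul_le_mul_of_nonneg_right hc hρ.le))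
  linarith

/-- Transversality: the parameters in `nearParameters` have small measure. -/
theorem volume_nearParameters_le {u v : List (Fin m₁) × List (Fin m₂)}
    (hY : 0 < |F₂.wordMap u.2 0 - F₂.wordMap v.2 0|) :
    volume (nearParameters F₁ F₂ c u v) ≤
      ENNReal.ofReal (2 * c / |F₂.wordMap u.2 0 - F₂.wordMap v.2 0|) := by
  set X := F₁.wordMap u.1 0 - F₁.wordMap v.1 0 with hX
  set Y := F₂.wordMap u.2 0 - F₂.wordMap v.2 0 with hYdef
  have hY0 : Y ≠ 0 := abs_pos.1 hY
  have hsub : nearParameters F₁ F₂ c u v ⊆ Icc (-X / Y - c / |Y|) (-X / Y + c / |Y|) := by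
    intro l hl
    rw [nearParameters, mem_ofPred_eq, ← hX, ← hYdef] at hl
    have h1 : X + l * Y = (l - -X / Y) * Y := by field_simp; ring
    rw [h1, abs_mul, ← le_div_iff₀ hY, abs_le] at hl
    constructor <;> linarith [hl.1, hl.2]
  refine (measure_mono hsub).trans ?_
  rw [Real.volume_Icc]
  exact ENNReal.ofReal_le_ofReal (le_of_eq (by ring))

/-- The number of elements of the `ρ`-decomposition in a box around a given one. -/
theorem card_box_le (h₁ : F₁.HasBoundedGeometry D) (h₂ : F₂.HasBoundedGeometry D)
    (hd : F₁.dim + F₂.dim < 1) (hρ : 0 < ρ) (hc : 1 ≤ 2 * c)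
    (S : Finset (List (Fin m₁) × List (Fin m₂)))
    (hS : (S : Set (List (Fin m₁) × List (Fin m₂))) ⊆ rhoDecomposition F₁ F₂ ρ) (x y : ℝ) (k : ℕ)
    (hx : ∀ v ∈ S, |F₁.wordMap v.1 0 - x| ≤ 2 * c * 2 ^ k * ρ)
    (hy : ∀ v ∈ S, |F₂.wordMap v.2 0 - y| ≤ 2 ^ k * ρ) :
    (S.card : ℝ) ≤ 18 * c * D ^ 8 * 2 ^ k := by
  classical
  have hD0 : 0 < D := by linarith [h₁.two_le]
  have h2k : (1 : ℝ) ≤ 2 ^ k := one_le_pow₀ (by norm_num)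
  have hS1 := h₁.card_near_le (x := x) (t := 2 * c * 2 ^ k * ρ) hρ
    (le_mul_of_one_le_left hρ.le (one_le_mul_of_one_le_of_one_le hc h2k)) (S.image Prod.fst)
    (by simp only [Finset.forall_mem_image]; exact fun v hv => (hS hv).1)
    (by simp only [Finset.forall_mem_image]; exact hx)
  have hS2 := h₂.card_near_le (x := y) (t := 2 ^ k * ρ) hρ
    (le_mul_of_one_le_left hρ.le h2k) (S.image Prod.snd)
    (by simp only [Finset.forall_mem_image]; exact fun v hv => (hS hv).2)
    (by simp only [Finset.forall_mem_image]; exact hy)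
  rw [mul_div_cancel_right₀ _ hρ.ne'] at hS1 hS2
  have hcard : (S.card : ℝ) ≤ (S.image Prod.fst).card * (S.image Prod.snd).card := by
    rw [← Nat.cast_mul, ← Finset.card_product]
    exact_mod_cast Finset.card_le_card (Finset.subset_product (s := S))
  -- The place where `d < 1` enters: it turns `(2 ^ k) ^ d` into at most `2 ^ k`.
  have hpow : (2 * c * 2 ^ k) ^ F₁.dim * ((2 : ℝ) ^ k) ^ F₂.dim ≤ 2 * c * 2 ^ k := by
    rw [Real.mul_rpow (by linarith) (by positivity), mul_assoc, ← Real.rpow_add (by positivity)]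
    refine mul_le_mul (Real.rpow_le_self_of_one_le hc F₁.dim_le_one)
      (Real.rpow_le_self_of_one_le h2k hd.le) (by positivity) (by linarith)
  have hc0 : 0 < c := by linarith
  calc (S.card : ℝ) ≤ _ := hcard
    _ ≤ _ := mul_le_mul hS1 hS2 (by positivity) (by positivity)
    _ = 9 * D ^ 8 * ((2 * c * 2 ^ k) ^ F₁.dim * ((2 : ℝ) ^ k) ^ F₂.dim) := by ring
    _ ≤ 9 * D ^ 8 * (2 * c * 2 ^ k) := mul_le_mul_of_nonneg_left hpow (by positivity)
    _ = _ := by ring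

/-- The cardinality of the `ρ`-decomposition. -/
theorem card_rhoDecomposition_le (h₁ : F₁.HasBoundedGeometry D) (h₂ : F₂.HasBoundedGeometry D)
    (hρ : 0 < ρ) (S : Finset (List (Fin m₁) × List (Fin m₂)))
    (hS : (S : Set (List (Fin m₁) × List (Fin m₂))) ⊆ rhoDecomposition F₁ F₂ ρ) :
    (S.card : ℝ) ≤ D ^ 2 * ρ ^ (-(F₁.dim + F₂.dim)) := by
  classical
  have hD0 : 0 < D := by linarith [h₁.two_le]
  have hD1 : 1 ≤ D := by linarith [h₁.two_le]
  have hS1' : ∀ v ∈ S.image Prod.fst, F₁.IsScaleWord ρ v := by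
    simp only [Finset.forall_mem_image]; exact fun v hv => (hS hv).1
  have hS2' : ∀ v ∈ S.image Prod.snd, F₂.IsScaleWord ρ v := by
    simp only [Finset.forall_mem_image]; exact fun v hv => (hS hv).2
  have hS1 := h₁.card_le (S.image Prod.fst)
    (fun u hu v hv h => (hS1' u hu).eq_of_prefix (hS1' v hv) h) hρ
    (fun u hu => (hS1' u hu).lt_size.le)
  have hS2 := h₂.card_le (S.image Prod.snd)
    (fun u hu v hv h => (hS2' u hu).eq_of_prefix (hS2' v hv) h) hρ
    (fun u hu => (hS2' u hu).lt_size.le)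
  have hcard : (S.card : ℝ) ≤ (S.image Prod.fst).card * (S.image Prod.snd).card := by
    rw [← Nat.cast_mul, ← Finset.card_product]
    exact_mod_cast Finset.card_le_card (Finset.subset_product (s := S))
  have hpow : ∀ d : ℝ, d ≤ 1 → (D / ρ) ^ d ≤ D * ρ ^ (-d) := by
    intro d hd
    rw [Real.div_rpow hD0.le hρ.le, Real.rpow_neg hρ.le, div_eq_mul_inv]
    exact mul_le_mul_of_nonneg_right (Real.rpow_le_self_of_one_le hD1 hd) (by positivity)
  calc (S.card : ℝ) ≤ _ := hcard
    _ ≤ (D * ρ ^ (-F₁.dim)) * (D * ρ ^ (-F₂.dim)) :=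
        mul_le_mul (hS1.trans (hpow _ F₁.dim_le_one)) (hS2.trans (hpow _ F₂.dim_le_one))
          (by positivity) (by positivity)
    _ = _ := by rw [neg_add, Real.rpow_add hρ]; ring

/-- The total measure of the parameters for which a given rectangle meets the other ones. -/
theorem sum_volume_nearParameters_le (h₁ : F₁.HasBoundedGeometry D)
    (h₂ : F₂.HasBoundedGeometry D) (hd : F₁.dim + F₂.dim < 1) (hρ : 0 < ρ) (hA : 0 < A)
    (hc : 2 * D * (1 + A) ≤ c) {K : ℕ} (hK : 1 ≤ 2 ^ K * ρ)
    (S : Finset (List (Fin m₁) × List (Fin m₂)))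
    (hS : (S : Set (List (Fin m₁) × List (Fin m₂))) ⊆ rhoDecomposition F₁ F₂ ρ)
    (u : List (Fin m₁) × List (Fin m₂)) :
    ∑ v ∈ S, volume (nearParameters F₁ F₂ (c * ρ) u v ∩ Icc (-A) A) ≤
      ENNReal.ofReal ((K + 1) * (72 * c ^ 2 * D ^ 8)) := by
  classical
  have hD2 := h₁.two_le
  have hcA : A ≤ c := by nlinarith
  have hc1 : 1 ≤ c := by nlinarith
  let box : ℕ → Finset (List (Fin m₁) × List (Fin m₂)) := fun k => S.filter fun v =>
    |F₁.wordMap v.1 0 - F₁.wordMap u.1 0| ≤ 2 * c * 2 ^ k * ρ ∧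
      |F₂.wordMap v.2 0 - F₂.wordMap u.2 0| ≤ 2 ^ k * ρ
  -- A majorant summed over every box containing `v`. Only the first dyadic scale is needed for the
  -- bound, but the overcount makes the order of summation easy to exchange.
  let b : List (Fin m₁) × List (Fin m₂) → ℝ := fun v =>
    ∑ k ∈ Finset.range (K + 1), if v ∈ box k then 4 * c / 2 ^ k else 0
  have hterm : ∀ v k, 0 ≤ if v ∈ box k then 4 * c / 2 ^ k else 0 := by
    intro v k; split_ifs <;> positivity
  have hvol : ∀ v ∈ S, volume (nearParameters F₁ F₂ (c * ρ) u v ∩ Icc (-A) A) ≤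
      ENNReal.ofReal (b v) := by
    intro v hv
    rcases (nearParameters F₁ F₂ (c * ρ) u v ∩ Icc (-A) A).eq_empty_or_nonempty with he | ⟨l, hl⟩
    · rw [he, measure_empty]; exact zero_le
    have hex : ∃ k, |F₂.wordMap u.2 0 - F₂.wordMap v.2 0| ≤ 2 ^ k * ρ := by
      refine ⟨K, le_trans ?_ hK⟩
      have e1 := F₂.wordMap_mapsTo_Icc u.2 (x := 0) ⟨le_rfl, zero_le_one⟩
      have e2 := F₂.wordMap_mapsTo_Icc v.2 (x := 0) ⟨le_rfl, zero_le_one⟩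
      rw [abs_le]
      constructor <;> linarith [e1.1, e1.2, e2.1, e2.2]
    have hkK : Nat.find hex ≤ K := by
      refine Nat.find_min' hex (le_trans ?_ hK)
      have e1 := F₂.wordMap_mapsTo_Icc u.2 (x := 0) ⟨le_rfl, zero_le_one⟩
      have e2 := F₂.wordMap_mapsTo_Icc v.2 (x := 0) ⟨le_rfl, zero_le_one⟩
      rw [abs_le]
      constructor <;> linarith [e1.1, e1.2, e2.1, e2.2]
    have hk := Nat.find_spec hex
    have hmin : ∀ j < Nat.find hex, 2 ^ j * ρ < |F₂.wordMap u.2 0 - F₂.wordMap v.2 0| :=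
      fun j hj => not_le.1 (Nat.find_min hex hj)
    generalize Nat.find hex = k at hkK hk hmin
    have hbox : v ∈ box k := by
      refine Finset.mem_filter.2 ⟨hv, ?_, by rwa [abs_sub_comm]⟩
      have e1 : |F₁.wordMap u.1 0 - F₁.wordMap v.1 0 +
        l * (F₂.wordMap u.2 0 - F₂.wordMap v.2 0)| ≤ c * ρ := hl.1
      have e2 : |l * (F₂.wordMap u.2 0 - F₂.wordMap v.2 0)| ≤ c * (2 ^ k * ρ) := by
        rw [abs_mul]
        exact mul_le_mul ((abs_le.2 hl.2).trans hcA) hk (abs_nonneg _) (by linarith)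
      have e3 := abs_sub_abs_le_abs_add (F₁.wordMap u.1 0 - F₁.wordMap v.1 0)
        (l * (F₂.wordMap u.2 0 - F₂.wordMap v.2 0))
      have e4 : c * ρ ≤ c * (2 ^ k * ρ) := mul_le_mul_of_nonneg_left
        (le_mul_of_one_le_left hρ.le (one_le_pow₀ (by norm_num))) (by linarith)
      rw [abs_sub_comm]
      linarith
    have hb : 4 * c / 2 ^ k ≤ b v := by
      have h := Finset.single_le_sum (f := fun k => if v ∈ box k then 4 * c / 2 ^ k else 0)
        (fun k _ => hterm v k) (Finset.mem_range.2 (Nat.lt_succ_of_le hkK))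
      simpa only [if_pos hbox] using h
    refine le_trans ?_ (ENNReal.ofReal_le_ofReal hb)
    -- At the lowest scale `Y` may vanish, so the trivial bound `2 * A` is used. At scale `j + 1`,
    -- minimality gives `|Y| > 2 ^ j * ρ`.
    cases k with
    | zero =>
      refine (measure_mono inter_subset_right).trans ?_
      rw [Real.volume_Icc]
      exact ENNReal.ofReal_le_ofReal (by rw [pow_zero, div_one]; linarith)
    | succ j =>
      have hj := hmin j j.lt_succ_self
      have hpos : 0 < 2 ^ j * ρ := by positivity
      refine (measure_mono inter_subset_left).trans
        ((volume_nearParameters_le (hpos.trans hj)).trans (ENNReal.ofReal_le_ofReal ?_))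
      refine (div_le_div_of_nonneg_left (by positivity) hpos hj.le).trans (le_of_eq ?_)
      rw [pow_succ]
      field_simp
      norm_num
  have hsum : ∑ v ∈ S, b v ≤ (K + 1) * (72 * c ^ 2 * D ^ 8) := by
    rw [Finset.sum_comm]
    have hk : ∀ k ∈ Finset.range (K + 1), (∑ v ∈ S, if v ∈ box k then 4 * c / 2 ^ k else 0) ≤
        72 * c ^ 2 * D ^ 8 := by
      intro k _
      rw [← Finset.sum_filter, Finset.sum_const, nsmul_eq_mul]
      have hfil : S.filter (fun v => v ∈ box k) = box k := by
        rw [Finset.filter_mem_eq_inter, Finset.inter_eq_right]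
        exact Finset.filter_subset _ _
      rw [hfil]
      have hcard := card_box_le h₁ h₂ hd hρ (by linarith) (box k)
        (fun v hv => hS (Finset.mem_filter.1 hv).1) _ _ k
        (fun v hv => (Finset.mem_filter.1 hv).2.1) (fun v hv => (Finset.mem_filter.1 hv).2.2)
      calc _ ≤ (18 * c * D ^ 8 * 2 ^ k) * (4 * c / 2 ^ k) :=
            mul_le_mul_of_nonneg_right hcard (by positivity)
        _ = _ := by field_simp; norm_num
    refine (Finset.sum_le_sum hk).trans (le_of_eq ?_)
    rw [Finset.sum_const, Finset.card_range, nsmul_eq_mul]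
    push_cast
    ring
  calc _ ≤ ∑ v ∈ S, ENNReal.ofReal (b v) := Finset.sum_le_sum hvol
    _ = ENNReal.ofReal (∑ v ∈ S, b v) :=
        (ENNReal.ofReal_sum_of_nonneg fun v _ => Finset.sum_nonneg fun k _ => hterm v k).symm
    _ ≤ _ := ENNReal.ofReal_le_ofReal hsum

/-! ### Good parameters -/

/-- Markov's inequality for the number of sets of a finite family that contain a point. -/
theorem volume_card_filter_mem_ge_le {ι : Type*} (s : Finset ι) (E : ι → Set ℝ)
    [∀ l, DecidablePred fun i => l ∈ E i] (hE : ∀ i, MeasurableSet (E i)) {I : Set ℝ}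
    {M T : ℝ} (hT : 0 < T)
    (hM : ∑ i ∈ s, volume (E i ∩ I) ≤ ENNReal.ofReal M) :
    MeasurableSet {l | ((s.filter fun i => l ∈ E i).card : ℝ) < T} ∧
      volume (I \ {l | ((s.filter fun i => l ∈ E i).card : ℝ) < T}) ≤ ENNReal.ofReal (M / T) := by
  classical
  -- The counting function as a sum of indicators; its integral over `I` is the sum of measures in
  -- `hM`.
  let Z : ℝ → ENNReal := fun l => ∑ i ∈ s, (E i).indicator 1 l
  have hZm : Measurable Z :=
    Finset.measurable_fun_sum s fun i _ => (measurable_one.indicator (hE i))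
  have hZ : ∀ l, Z l = ENNReal.ofReal ((s.filter fun i => l ∈ E i).card : ℝ) := by
    intro l
    rw [ENNReal.ofReal_natCast, Finset.card_filter, Nat.cast_sum]
    refine Finset.sum_congr rfl fun i _ => ?_
    by_cases h : l ∈ E i <;> simp [h]
  have hset : {l | ((s.filter fun i => l ∈ E i).card : ℝ) < T} = {l | Z l < ENNReal.ofReal T} := by
    ext l
    rw [mem_ofPred_eq, mem_ofPred_eq, hZ, ENNReal.ofReal_lt_ofReal_iff hT]
  have hmeas : MeasurableSet {l | Z l < ENNReal.ofReal T} :=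
    measurableSet_lt hZm measurable_const
  rw [hset]
  refine ⟨hmeas, ?_⟩
  have hint : ∫⁻ l in I, Z l ≤ ENNReal.ofReal M := by
    rw [lintegral_finsetSum _ fun i _ => measurable_one.indicator (hE i)]
    refine le_trans (le_of_eq (Finset.sum_congr rfl fun i _ => ?_)) hM
    rw [lintegral_indicator_one (hE i), Measure.restrict_apply (hE i)]
  have hmarkov := meas_ge_le_lintegral_div (μ := volume.restrict I) hZm.aemeasurable
    (ENNReal.ofReal_pos.2 hT).ne' ENNReal.ofReal_ne_top
  rw [Measure.restrict_apply (measurableSet_le measurable_const hZm)] at hmarkov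
  have hsub : I \ {l | Z l < ENNReal.ofReal T} ⊆ {l | ENNReal.ofReal T ≤ Z l} ∩ I :=
    fun l hl => ⟨show ENNReal.ofReal T ≤ Z l from le_of_not_gt fun h => hl.2 h, hl.1⟩
  refine (measure_mono hsub).trans (hmarkov.trans ?_)
  rw [ENNReal.ofReal_div_of_pos hT]
  exact ENNReal.div_le_div_right hint _

/-- The proposition with a scale that is uniform over systems of bounded geometry. -/
theorem exists_uniform_scale {η₀ A₁ : ℝ} (hη₀ : 0 < η₀) (hA₁ : 0 < A₁) (hD : 2 ≤ D) :
    ∃ r > 0, ∀ (η A : ℝ) (F₁ : RegularNormalizedIFS m₁) (F₂ : RegularNormalizedIFS m₂),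
      η₀ ≤ η → 0 < A → A ≤ A₁ → F₁.HasBoundedGeometry D → F₂.HasBoundedGeometry D →
      F₁.dim + F₂.dim < 1 → ∀ ρ : ℝ, 0 < ρ → ρ < r →
        ∃ J : Set ℝ, J ⊆ Icc (-A) A ∧ MeasurableSet J ∧
          volume (Icc (-A) A \ J) < ENNReal.ofReal (ρ ^ η) ∧
          ∀ l ∈ J, ∀ R : Finset (List (Fin m₁) × List (Fin m₂)),
            (R : Set (List (Fin m₁) × List (Fin m₂))) ⊆ rhoDecomposition F₁ F₂ ρ →
            ρ ^ (η - (F₁.dim + F₂.dim)) < (R.card : ℝ) →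
            IsFaithful F₁ F₂ ρ (4 * η) l (id, id) R := by
  classical
  set c := 2 * D * (1 + A₁) with hcdef
  have hc0 : 0 < c := by positivity
  -- One factor `ρ ^ (-ε)` pays for the number of dyadic scales and another for the constant `C`;
  -- together they fit into the slack `ρ ^ (-(η / 2))`.
  set ε := η₀ / 4 with hε
  have hε0 : 0 < ε := by positivity
  set C := 72 * c ^ 2 * D ^ 10 * (2 / ε + 2) with hC
  have hC0 : 0 < C := by positivity
  -- Below this scale `ρ ^ ε * (4 + C) < 1`, which absorbs both `C` and the factor `4` from the
  -- independent set bound.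
  refine ⟨(1 / (4 + C)) ^ (1 / ε), by positivity, ?_⟩
  intro η A F₁ F₂ hη hA hA1 h₁ h₂ hd ρ hρ hρr
  have hρε : ρ ^ ε < 1 / (4 + C) := by
    have h := Real.rpow_lt_rpow hρ.le hρr hε0
    rwa [← Real.rpow_mul (by positivity), one_div_mul_cancel hε0.ne', Real.rpow_one] at h
  have hρ1 : ρ < 1 := by
    refine hρr.trans (Real.rpow_lt_one (by positivity) ?_ (by positivity))
    rw [div_lt_one (by positivity)]; linarith
  have hρε' : ρ ^ ε * (4 + C) < 1 := by rwa [lt_div_iff₀ (by positivity)] at hρε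
  have hρε0 : 0 < ρ ^ ε := by positivity
  set d := F₁.dim + F₂.dim with hddef
  obtain ⟨n, hn1, hn2⟩ := exists_nat_pow_near (x := 1 / ρ) (y := 2)
    (by rw [le_div_iff₀ hρ]; linarith) (by norm_num)
  have hK : 1 ≤ 2 ^ (n + 1) * ρ := by rw [div_lt_iff₀ hρ] at hn2; exact hn2.le
  have hn : ((n + 1 : ℕ) : ℝ) + 1 ≤ (2 / ε + 2) * ρ ^ (-ε) := by
    have e1 : (n : ℝ) * Real.log 2 ≤ Real.log (1 / ρ) := by
      rw [← Real.log_pow]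
      exact Real.log_le_log (by positivity) hn1
    have e2 := Real.log_le_rpow_div (x := 1 / ρ) (by positivity) hε0
    have e3 : (1 / ρ) ^ ε = ρ ^ (-ε) := by
      rw [one_div, Real.inv_rpow hρ.le, Real.rpow_neg hρ.le]
    rw [e3] at e2
    have e4 : 1 ≤ ρ ^ (-ε) := Real.one_le_rpow_of_pos_of_le_one_of_nonpos hρ hρ1.le (by linarith)
    have e5 : (n : ℝ) ≤ 2 * (ρ ^ (-ε) / ε) := by
      have := Real.log_two_gt_d9
      nlinarith [Nat.cast_nonneg (α := ℝ) n]
    have e6 : (2 / ε + 2) * ρ ^ (-ε) = 2 * (ρ ^ (-ε) / ε) + 2 * ρ ^ (-ε) := by ring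
    rw [e6]
    push_cast
    linarith
  set Λ := (rhoDecomposition_finite F₁ F₂ hρ).toFinset with hΛ
  have hΛsub : (Λ : Set (List (Fin m₁) × List (Fin m₂))) ⊆ rhoDecomposition F₁ F₂ ρ := by
    rw [hΛ, Finite.coe_toFinset]
  have hcA : 2 * D * (1 + A) ≤ c := mul_le_mul_of_nonneg_left (by linarith) (by linarith)
  set M := D ^ 2 * ρ ^ (-d) * (((n + 1 : ℕ) + 1) * (72 * c ^ 2 * D ^ 8)) with hM
  -- The exponent splits the room evenly: a factor `ρ ^ (-(η / 2))` is left over in the Markov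
  -- estimate and again in the cardinality estimate `e2`.
  set T := ρ ^ (-d - 3 / 2 * η) with hT
  have hT0 : 0 < T := by positivity
  have hMsum : ∑ p ∈ Λ ×ˢ Λ, volume (nearParameters F₁ F₂ (c * ρ) p.1 p.2 ∩ Icc (-A) A) ≤
      ENNReal.ofReal M := by
    rw [Finset.sum_product]
    refine (Finset.sum_le_sum fun u _ =>
      sum_volume_nearParameters_le h₁ h₂ hd hρ hA hcA hK Λ hΛsub u).trans ?_
    rw [Finset.sum_const, nsmul_eq_mul, ← ENNReal.ofReal_natCast,
      ← ENNReal.ofReal_mul (by positivity)]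
    exact ENNReal.ofReal_le_ofReal
      (mul_le_mul_of_nonneg_right (card_rhoDecomposition_le h₁ h₂ hρ Λ hΛsub) (by positivity))
  obtain ⟨hJm, hJv⟩ := volume_card_filter_mem_ge_le (Λ ×ˢ Λ)
    (fun p => nearParameters F₁ F₂ (c * ρ) p.1 p.2)
    (fun p => (isClosed_nearParameters p.1 p.2).measurableSet) hT0 hMsum
  set G := {l : ℝ | (((Λ ×ˢ Λ).filter fun p => l ∈ nearParameters F₁ F₂ (c * ρ) p.1 p.2).card : ℝ)
    < T} with hG
  have hMT : M / T < ρ ^ η := by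
    rw [div_lt_iff₀ hT0, hT, ← Real.rpow_add hρ]
    have e1 : M ≤ C * ρ ^ (-d - ε) := by
      calc M ≤ D ^ 2 * ρ ^ (-d) * ((2 / ε + 2) * ρ ^ (-ε) * (72 * c ^ 2 * D ^ 8)) := by
            rw [hM]; gcongr
        _ = C * (ρ ^ (-d) * ρ ^ (-ε)) := by rw [hC]; ring
        _ = _ := by rw [← Real.rpow_add hρ]; ring_nf
    have e2 : C * ρ ^ (-d - ε) < ρ ^ (-d - 2 * ε) := by
      have : ρ ^ (-d - ε) = ρ ^ ε * ρ ^ (-d - 2 * ε) := by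
        rw [← Real.rpow_add hρ]; ring_nf
      rw [this, ← mul_assoc]
      refine mul_lt_of_lt_one_left (by positivity) ?_
      linarith
    refine e1.trans_lt (e2.trans_le (Real.rpow_le_rpow_of_exponent_ge hρ hρ1.le ?_))
    linarith
  refine ⟨Icc (-A) A ∩ G, inter_subset_left, measurableSet_Icc.inter hJm, ?_, ?_⟩
  · rw [sdiff_self_inter]
    exact hJv.trans_lt ((ENNReal.ofReal_lt_ofReal_iff (by positivity)).2 hMT)
  rintro l ⟨hlA, hlG⟩ R hR hRcard
  have hRΛ : R ⊆ Λ := fun u hu => (rhoDecomposition_finite F₁ F₂ hρ).mem_toFinset.2 (hR hu)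
  -- Near pairs in `R` are among those in `Λ`, so a single good set serves every `R`.
  have hpairs : (((R ×ˢ R).filter fun p => l ∈ nearParameters F₁ F₂ (c * ρ) p.1 p.2).card : ℝ) ≤ T :=
    (Nat.cast_le.2 (Finset.card_le_card (Finset.filter_subset_filter _
      (Finset.product_subset_product hRΛ hRΛ)))).trans (le_of_lt hlG)
  obtain ⟨R', hR'R, hR'card, hR'⟩ := exists_pairwise_not_of_card_le R
    (fun u v => l ∈ nearParameters F₁ F₂ (c * ρ) u v) (fun u v h => nearParameters_symm h)
    (fun u => mem_nearParameters_self (by positivity) u l) hpairs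
  refine ⟨R', hR'R, ?_, fun u hu v hv huv => ?_⟩
  · have e1 : (ρ ^ (η - d)) ^ 2 < 4 * T * R'.card :=
      (pow_lt_pow_left₀ hRcard (by positivity) two_ne_zero).trans_le hR'card
    have e2 : (ρ ^ (η - d)) ^ 2 = ρ ^ (-(η / 2)) * (T * ρ ^ (4 * η - d)) := by
      rw [hT, ← Real.rpow_add hρ, ← Real.rpow_add hρ, ← Real.rpow_natCast, ← Real.rpow_mul hρ.le]
      congr 1
      push_cast
      ring
    have e3 : 4 ≤ ρ ^ (-(η / 2)) := by
      have e4 : ρ ^ (η / 2) ≤ ρ ^ ε :=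
        Real.rpow_le_rpow_of_exponent_ge hρ hρ1.le (by linarith)
      have e5 : 0 < ρ ^ (η / 2) := by positivity
      rw [Real.rpow_neg hρ.le, le_inv_comm₀ (by norm_num) e5]
      nlinarith
    have e6 : 4 * T * ρ ^ (4 * η - d) < 4 * T * R'.card := by
      refine lt_of_le_of_lt ?_ e1
      rw [e2, mul_assoc]
      exact mul_le_mul_of_nonneg_right e3 (by positivity)
    exact lt_of_mul_lt_mul_left e6 (by positivity)
  · by_contra hnd
    exact hR' hu hv huv (mem_nearParameters_of_not_disjoint h₁ h₂ hρ hcA (hR (hR'R hu))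
      (hR (hR'R hv)) hlA hnd)

/-! ### Continuous dependence of the threshold -/

/-- Only a pseudometric: systems whose maps agree on `[0,1]` are not separated. -/
instance (m : ℕ) : TopologicalSpace.PseudoMetrizableSpace (RegularNormalizedIFS m) :=
  (⟨rfl⟩ : Topology.IsInducing (RegularNormalizedIFS.jet (m := m))).pseudoMetrizableSpace

theorem mainTheorem3 (m₁ m₂ : ℕ) :
    ∃ ρ₀ : ℝ × ℝ × RegularNormalizedIFS m₁ × RegularNormalizedIFS m₂ → ℝ,
      ContinuousOn ρ₀ {p | 0 < p.1 ∧ 0 < p.2.1 ∧ p.2.2.1.dim + p.2.2.2.dim < 1} ∧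
      ∀ (η A : ℝ) (F₁ : RegularNormalizedIFS m₁) (F₂ : RegularNormalizedIFS m₂),
        0 < η → 0 < A → F₁.dim + F₂.dim < 1 →
        0 < ρ₀ (η, A, F₁, F₂) ∧
        ∀ ρ : ℝ, 0 < ρ → ρ < ρ₀ (η, A, F₁, F₂) →
          ∃ J : Set ℝ, J ⊆ Icc (-A) A ∧ MeasurableSet J ∧
            volume (Icc (-A) A \ J) < ENNReal.ofReal (ρ ^ η) ∧
            ∀ l ∈ J, ∀ R : Finset (List (Fin m₁) × List (Fin m₂)),
              (R : Set (List (Fin m₁) × List (Fin m₂))) ⊆ rhoDecomposition F₁ F₂ ρ →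
              ρ ^ (η - (F₁.dim + F₂.dim)) < (R.card : ℝ) →
              IsFaithful F₁ F₂ ρ (4 * η) l (id, id) R := by
  obtain ⟨ρ₀, hcont, hρ₀⟩ := exists_continuousOn_radius
    {p : ℝ × ℝ × RegularNormalizedIFS m₁ × RegularNormalizedIFS m₂ |
      0 < p.1 ∧ 0 < p.2.1 ∧ p.2.2.1.dim + p.2.2.2.dim < 1}
    (fun p r => ∀ ρ : ℝ, 0 < ρ → ρ < r →
      ∃ J : Set ℝ, J ⊆ Icc (-p.2.1) p.2.1 ∧ MeasurableSet J ∧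
        volume (Icc (-p.2.1) p.2.1 \ J) < ENNReal.ofReal (ρ ^ p.1) ∧
        ∀ l ∈ J, ∀ R : Finset (List (Fin m₁) × List (Fin m₂)),
          (R : Set (List (Fin m₁) × List (Fin m₂))) ⊆ rhoDecomposition p.2.2.1 p.2.2.2 ρ →
          ρ ^ (p.1 - (p.2.2.1.dim + p.2.2.2.dim)) < (R.card : ℝ) →
          IsFaithful p.2.2.1 p.2.2.2 ρ (4 * p.1) l (id, id) R)
    (fun p r r' hr h ρ hρ hρr => h ρ hρ (hρr.trans_le hr))
    (by
      rintro ⟨η, A, F₁, F₂⟩ ⟨hη, hA, -⟩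
      obtain ⟨D₁, hD₁⟩ := F₁.eventually_hasBoundedGeometry
      obtain ⟨D₂, hD₂⟩ := F₂.eventually_hasBoundedGeometry
      have hη' : 0 < η := hη
      have hA' : 0 < A := hA
      obtain ⟨r, hr, h⟩ := exists_uniform_scale (m₁ := m₁) (m₂ := m₂) (D := max D₁ D₂)
        (half_pos hη') (show 0 < A + 1 by linarith)
        (hD₁.self_of_nhds.two_le.trans (le_max_left _ _))
      refine ⟨r, hr, ?_⟩
      rw [nhds_prod_eq, nhds_prod_eq, nhds_prod_eq]
      -- Near the given point the exponent stays above `η / 2`, the bound on parameters below `A +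
      -- 1`, and the distortion constant is common; these are the inputs of the uniform scale.
      filter_upwards [(eventually_ge_nhds (half_lt_self hη')).prod_mk
        ((eventually_le_nhds (lt_add_one A)).prod_mk (hD₁.prod_mk hD₂))]
      rintro ⟨η', A', G₁, G₂⟩ ⟨e1, e2, e3, e4⟩ ⟨f1, f2, f3⟩
      exact h η' A' G₁ G₂ e1 f2 e2 (e3.mono (le_max_left _ _)) (e4.mono (le_max_right _ _)) f3)
  exact ⟨ρ₀, hcont, fun η A F₁ F₂ hη hA hd => hρ₀ (η, A, F₁, F₂) ⟨hη, hA, hd⟩⟩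

end
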